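/- **Setting.** Let $(E,\mathcal B)$ be a measurable space and let $\nu=\nu_0,\nu_1,\nu_2,\dots$ be probability measures on it, carried by pairwise disjoint sets $E_n\in\mathcal B$, i.e. $\nu_n(E\setminus E_n)=0$ for $n\ge 0$. Assume that $\nu$ has a countable base (there is a countable family of measurable sets that is dense in $\mathcal B$ for the distance $\nu(A\triangle B)$). Let $\alpha_n>0$, $\sum_{n\ge0}\alpha_n=1$, $\mathbb M=\sum_{n\ge 0}\alpha_n\nu_n$; functions on $E$ are identified if they are equal $\mathbb M$-a.e. All $L^2$-spaces are real, $\langle\cdot,\cdot\rangle_n$ is the inner product of $L^2(E,\nu_n)$ and $\langle\cdot,\cdot\rangle=\langle\cdot,\cdot\rangle_0$. Put $\mathcal D=\{\varphi\in\bigcap_{n\ge0}L^2(E,\nu_n):\langle\varphi,\varphi\rangle_n\to\langle\varphi,\varphi\rangle\}$, let $\mathcal F\subseteq\mathcal D$ be a linear space that is dense in $L^2(E,\nu)$, and let $\mathcal C$ be the set of all $\varphi\in\mathcal D$ such that * (c1) for every $n\ge1$ there is $\varphi_n\in\mathcal F$ with $\varphi=\varphi_n$ $\nu_n$-a.e.;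 * (c2) $\langle\varphi,\psi\rangle_n\to\langle\varphi,\psi\rangle$ for all $\psi\in\mathcal F$. An element of $L^2(E,\nu_n)$ is said to be in $\mathcal C$ if it coincides $\nu_n$-a.e. with an element of $\mathcal C$. A sequence $\varphi_n\in\mathcal C$, $n\ge 1$, *w-converges* to $\varphi\in L^2(E,\nu)$ if $\langle\varphi_n,\psi\rangle_n\to\langle\varphi,\psi\rangle$ for all $\psi\in\mathcal C$; it *s-converges* to $\varphi$ if moreover $\langle\varphi_n,\varphi_n\rangle_n\to\langle\varphi,\varphi\rangle$. For subsequences $\varphi_{n_k}$ ($1\le n_1<n_2<\cdots$), the index $n$ is replaced by $n_k$. For $n\ge1$ let $(T_{n,t})_{t\ge0}$ be a strongly continuous contraction semigroup on $L^2(E,\nu_n)$ with generator $A_n$, resolvents $G_{n,\beta}=\int_0^\infty e^{-\beta t}T_{n,t}\,dt$ ($\beta>0$) and form $S_n(u,v)=-\langle A_nu,v\rangle_n$ for $u\in D(S_n)=D(A_n)$, $v\in L^2(E,\nu_n)$; put $S_{n,\beta}(u,v)=\beta\langle u,v\rangle_n+S_n(u,v)$. Let $(T_t)$, $A$, $G_\beta$,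 $S$, $S_\beta$ be the corresponding objects on $L^2(E,\nu)$. $G'_{n,\beta}$ and $G'_\beta$ denote the resolvents of the dual (adjoint) semigroups. * (c3) For all $g\in\mathcal C$, $\beta>0$ and $n\ge1$: $G_\beta g$, $G_{n,\beta}g$, $G'_\beta g$, $G'_{n,\beta}g$ are in $\mathcal C$. The forms $S_n$ *converge* to $S$ if (i)–(iii) hold: * (i) If a subsequence $\varphi_{n_k}\in D(S_{n_k})\cap\mathcal C$ w-converges to $\varphi\in L^2(E,\nu)$ and $\sup_k\langle A_{n_k}\varphi_{n_k},A_{n_k}\varphi_{n_k}\rangle_{n_k}<\infty$, then $\varphi\in D(S)$ and $S(\varphi,\varphi)\le\liminf_kS_{n_k}(\varphi_{n_k},\varphi_{n_k})$. * (ii) For every $\psi\in D(S)$ there are $\psi_n\in D(S_n)\cap\mathcal C$, $n\ge1$, s-converging to $\psi$, with $\sup_n\langle A_n\psi_n,A_n\psi_n\rangle_n<\infty$ and $\limsup_nS_n(\psi_n,\psi_n)\le S(\psi,\psi)$. * (iii) Let $\beta>0$, let $u_n\in D(S_n)\cap\mathcal C$ with $A_nu_n\in\mathcal C$ be w-convergent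 to some limit with $\sup_n\langle A_nu_n,A_nu_n\rangle_n<\infty$, and let $u\in D(S)$. If $S_{n,\beta}(u_n,\psi_n)\to S_\beta(u,\psi)$ for all $\psi\in\mathcal C$ and all $\psi_n\in\mathcal C$ s-converging to $\psi$, then $S_{n,\beta}(\psi_n,u_n)\to S_\beta(\psi,u)$ for all $\psi\in D(S)$ and all $\psi_n\in D(S_n)\cap\mathcal C$ that s-converge to $\psi$ with the two additional properties in (ii). The same is required along every subsequence $n_k$ of the indices (with $u_{n_k}$, $\psi_{n_k}$ in place of $u_n$, $\psi_n$). **Theorem 2.7.** Assume (c3), let $\beta>0$, and suppose that the forms $S_n$ converge to $S$. (a) For all $f\in L^2(E,\nu)$ and all $f_n\in\mathcal C$, $n\ge1$, w-converging to $f$: $G_{n,\beta}f_n$ w-converges to $G_\beta f$ and $G'_{n,\beta}f_n$ w-converges to $G'_\beta f$. (b) For all $g\in L^2(E,\nu)$ and all $g_n\in\mathcal C$, $n\ge1$, s-converging to $g$: $G_{n,\beta}g_n$ s-converges to $G_\beta g$ and $G'_{n,\beta}g_n$ s-converges to $G'_\beta g$. -/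

import Mathlib

open MeasureTheory Filter Topology
open scoped NNReal ENNReal

noncomputable section

/-! ## Strongly continuous contraction semigroups on a real Hilbert space -/

/-- A strongly continuous semigroup `(T_t)_{t ≥ 0}` of linear contractions on `H`. -/
structure ContractionSemigroup (H : Type*) [NormedAddCommGroup H] [InnerProductSpace ℝ H] where
  /-- the operators `T_t`, `t ≥ 0` -/
  op : ℝ≥0 → H →L[ℝ] H
  op_zero : op 0 = ContinuousLinearMap.id ℝ H
  op_add : ∀ s t, op (s + t) = (op s).comp (op t)
  norm_op_le : ∀ t, ‖op t‖ ≤ 1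
  tendsto_op : ∀ x, Tendsto (fun t => op t x) (𝓝 0) (𝓝 x)

namespace ContractionSemigroup

variable {H : Type*} [NormedAddCommGroup H] [InnerProductSpace ℝ H]

/-- The domain `D(A)` of the generator: all `u` for which `(T_t u - u) / t` converges in norm
as `t ↓ 0`. It is also the domain `D(S)` of the associated bilinear form. -/
def domain (T : ContractionSemigroup H) : Set H :=
  {u | ∃ v, Tendsto (fun t : ℝ≥0 => t⁻¹ • (T.op t u - u)) (𝓝[>] 0) (𝓝 v)}

/-- The generator `A u = lim_{t ↓ 0} (T_t u - u) / t` (meaningful for `u ∈ D(A)` only). -/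
def generator (T : ContractionSemigroup H) (u : H) : H :=
  limUnder (𝓝[>] 0) fun t : ℝ≥0 => t⁻¹ • (T.op t u - u)

/-- The bilinear form `S(u, v) = -⟨A u, v⟩ = lim_{t ↓ 0} ⟨(u - T_t u) / t, v⟩`, for `u ∈ D(S)`
and arbitrary `v ∈ H`. -/
def form (T : ContractionSemigroup H) (u v : H) : ℝ :=
  -inner ℝ (T.generator u) v

/-- The form `S_β(u, v) = β ⟨u, v⟩ + S(u, v)`, for `u ∈ D(S)` and arbitrary `v ∈ H`. -/
def formShift (T : ContractionSemigroup H) (β : ℝ) (u v : H) : ℝ :=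
  β * inner ℝ u v + T.form u v

/-- The resolvent `G_β f = ∫_0^∞ e^{-β t} T_t f dt`, for `β > 0`. -/
def resolvent (T : ContractionSemigroup H) (β : ℝ) (f : H) : H :=
  ∫ t in Set.Ioi (0 : ℝ), Real.exp (-(β * t)) • T.op t.toNNReal f

/-- The dual semigroup `(T'_t)_{t ≥ 0}`, consisting of the adjoint operators. -/
def dual [CompleteSpace H] (T : ContractionSemigroup H) : ContractionSemigroup H where
  op t := ContinuousLinearMap.adjoint (T.op t)
  op_zero := by
    rw [T.op_zero]
    exact ContinuousLinearMap.adjoint_id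
  op_add s t := by
    rw [add_comm, T.op_add, ContinuousLinearMap.adjoint_comp]
  norm_op_le t := by
    rw [LinearIsometryEquiv.norm_map]
    exact T.norm_op_le t
  tendsto_op x := by
    have h1 : Tendsto (fun t => 2 * (‖x‖ ^ 2 - inner ℝ x (T.op t x))) (𝓝 0) (𝓝 0) := by
      have h := ((tendsto_const_nhds (x := x)).inner (𝕜 := ℝ) (T.tendsto_op x))
      have h' := (tendsto_const_nhds (x := ‖x‖ ^ 2)).sub h
      simpa [real_inner_self_eq_norm_sq] using h'.const_mul 2
    have h2 : Tendsto (fun t => ‖ContinuousLinearMap.adjoint (T.op t) x - x‖ ^ 2)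
        (𝓝 0) (𝓝 0) := by
      refine squeeze_zero (fun t => by positivity) (fun t => ?_) h1
      rw [norm_sub_sq_real, ContinuousLinearMap.adjoint_inner_left]
      have h3 : ‖ContinuousLinearMap.adjoint (T.op t) x‖ ≤ ‖x‖ := by
        refine (ContinuousLinearMap.le_opNorm _ x).trans ?_
        rw [LinearIsometryEquiv.norm_map]
        exact mul_le_of_le_one_left (norm_nonneg x) (T.norm_op_le t)
      have h4 := pow_le_pow_left₀ (norm_nonneg _) h3 2
      linarith
    rw [tendsto_iff_norm_sub_tendsto_zero]
    have h5 := h2.sqrt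
    simpa [Real.sqrt_sq] using h5

end ContractionSemigroup

/-! ## The function classes `𝒟` and `𝒞` over a sequence of measures

Throughout, `ν 0` is the distinguished (limit) measure and `ν 1, ν 2, …` is the sequence. -/

namespace MoscoSeq

variable {E : Type*} [MeasurableSpace E]

/-- The mixture `𝕄 = ∑_{n ≥ 0} α_n ν_n`. -/
def mixture (α : ℕ → ℝ≥0) (ν : ℕ → Measure E) : Measure E :=
  Measure.sum fun n => α n • ν n

/-- The pairing `⟨φ, ψ⟩_n = ∫ φ ψ dν_n`. -/
def pairing (ν : ℕ → Measure E) (n : ℕ) (φ ψ : E → ℝ) : ℝ :=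
  ∫ x, φ x * ψ x ∂ν n

variable (α : ℕ → ℝ≥0) (ν : ℕ → Measure E)

/-- The class `𝒟` of all `𝕄`-classes `φ` in `⋂_{n ≥ 0} L²(E, ν_n)` such that
`⟨φ, φ⟩_n → ⟨φ, φ⟩_0`. -/
def classD : Set (E →ₘ[mixture α ν] ℝ) :=
  {φ | (∀ n, MemLp φ 2 (ν n)) ∧
    Tendsto (fun n => pairing ν n φ φ) atTop (𝓝 (pairing ν 0 φ φ))}

variable {α}

/-- The elements of `L²(E, ν_n)` that coincide `ν_n`-a.e. with some element of `X`. -/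
def trace (X : Set (E →ₘ[mixture α ν] ℝ)) (n : ℕ) : Set (Lp ℝ 2 (ν n)) :=
  {u | ∃ φ ∈ X, ⇑u =ᵐ[ν n] ⇑φ}

/-- The class `𝒞` of all `φ ∈ 𝒟` such that, for every `n ≥ 1`, some `χ ∈ ℱ` satisfies `φ = χ`
`ν_n`-a.e. (representing sequence), and `⟨φ, ψ⟩_n → ⟨φ, ψ⟩_0` for all `ψ ∈ ℱ`. -/
def classC (F : Submodule ℝ (E →ₘ[mixture α ν] ℝ)) : Set (E →ₘ[mixture α ν] ℝ) :=
  {φ | φ ∈ classD α ν ∧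
    (∀ n, 1 ≤ n → ∃ χ ∈ F, ⇑φ =ᵐ[ν n] ⇑χ) ∧
    ∀ ψ ∈ F, Tendsto (fun n => pairing ν n φ ψ) atTop (𝓝 (pairing ν 0 φ ψ))}

/-- `σ 0 < σ 1 < …` enumerates a subsequence of the indices `1, 2, 3, …`. The whole sequence is
`σ k = k + 1`. -/
def IsSubseq (σ : ℕ → ℕ) : Prop :=
  StrictMono σ ∧ ∀ k, 1 ≤ σ k

variable {ν}

/-- w-convergence, along the indices `n = σ k`, of elements `φ_n` of `𝒞` (given through their
`ν_n`-classes) to `f ∈ L²(E, ν_0)`. -/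
def WConv (F : Submodule ℝ (E →ₘ[mixture α ν] ℝ)) (σ : ℕ → ℕ)
    (φ : ∀ k, Lp ℝ 2 (ν (σ k))) (f : Lp ℝ 2 (ν 0)) : Prop :=
  (∀ k, φ k ∈ trace ν (classC ν F) (σ k)) ∧
    ∀ ψ ∈ classC ν F,
      Tendsto (fun k => pairing ν (σ k) (φ k) ψ) atTop (𝓝 (pairing ν 0 f ψ))

/-- s-convergence, along the indices `n = σ k`: w-convergence together with convergence of the
squared norms. -/
def SConv (F : Submodule ℝ (E →ₘ[mixture α ν] ℝ)) (σ : ℕ → ℕ)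
    (φ : ∀ k, Lp ℝ 2 (ν (σ k))) (f : Lp ℝ 2 (ν 0)) : Prop :=
  WConv F σ φ f ∧
    Tendsto (fun k => inner ℝ (φ k) (φ k)) atTop (𝓝 (inner ℝ f f))

/-- Stability of `𝒞` under the resolvents and the dual resolvents: for all `n ≥ 0` (so for the
limit semigroup `T 0` as well), `β > 0` and `g ∈ 𝒞`, each of `G_{n,β} g` and `G'_{n,β} g`
coincides `ν_n`-a.e. with an element of `𝒞`. -/
def ResolventStable (F : Submodule ℝ (E →ₘ[mixture α ν] ℝ))
    (T : ∀ n, ContractionSemigroup (Lp ℝ 2 (ν n))) : Prop :=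
  ∀ n, ∀ β : ℝ, 0 < β → ∀ g ∈ trace ν (classC ν F) n,
    (T n).resolvent β g ∈ trace ν (classC ν F) n ∧
      (T n).dual.resolvent β g ∈ trace ν (classC ν F) n

/-- `sup_k ⟨A_n u_n, A_n u_n⟩_n < ∞`, where `n = σ k`. -/
def BddGenerators (T : ∀ n, ContractionSemigroup (Lp ℝ 2 (ν n))) (σ : ℕ → ℕ)
    (u : ∀ k, Lp ℝ 2 (ν (σ k))) : Prop :=
  BddAbove (Set.range fun k =>
    inner ℝ ((T (σ k)).generator (u k)) ((T (σ k)).generator (u k)))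

/-- `ψ_n ∈ D(S_n) ∩ 𝒞`, `n = σ k`, is a recovery sequence for `ψ`: it s-converges to `ψ`,
`sup_n ⟨A_n ψ_n, A_n ψ_n⟩_n < ∞`, and `limsup_n S_n(ψ_n, ψ_n) ≤ S(ψ, ψ)`. -/
def IsRecovery (F : Submodule ℝ (E →ₘ[mixture α ν] ℝ))
    (T : ∀ n, ContractionSemigroup (Lp ℝ 2 (ν n))) (σ : ℕ → ℕ)
    (ψs : ∀ k, Lp ℝ 2 (ν (σ k))) (ψ : Lp ℝ 2 (ν 0)) : Prop :=
  (∀ k, ψs k ∈ (T (σ k)).domain) ∧ SConv F σ ψs ψ ∧ BddGenerators T σ ψs ∧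
    limsup (fun k => (((T (σ k)).form (ψs k) (ψs k) : ℝ) : EReal)) atTop
      ≤ (((T 0).form ψ ψ : ℝ) : EReal)

/-- Condition (i). With the convention `S(φ, φ) = ∞` for `φ ∉ D(S)`, the inequality contains the
assertion `φ ∈ D(S)`, which is spelled out. -/
def LowerBound (F : Submodule ℝ (E →ₘ[mixture α ν] ℝ))
    (T : ∀ n, ContractionSemigroup (Lp ℝ 2 (ν n))) : Prop :=
  ∀ σ : ℕ → ℕ, IsSubseq σ → ∀ (φs : ∀ k, Lp ℝ 2 (ν (σ k))) (φ : Lp ℝ 2 (ν 0)),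
    (∀ k, φs k ∈ (T (σ k)).domain) → WConv F σ φs φ → BddGenerators T σ φs →
    φ ∈ (T 0).domain ∧
      (((T 0).form φ φ : ℝ) : EReal) ≤
        liminf (fun k => (((T (σ k)).form (φs k) (φs k) : ℝ) : EReal)) atTop

/-- Condition (ii): every `ψ ∈ D(S)` has a recovery sequence. -/
def HasRecovery (F : Submodule ℝ (E →ₘ[mixture α ν] ℝ))
    (T : ∀ n, ContractionSemigroup (Lp ℝ 2 (ν n))) : Prop :=
  ∀ ψ ∈ (T 0).domain, ∃ ψs : ∀ k, Lp ℝ 2 (ν (k + 1)), IsRecovery F T (fun k => k + 1) ψs ψ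

/-- Condition (iii), required along subsequences of indices. Let `β > 0`, let
`u_n ∈ D(S_n) ∩ 𝒞` with `A_n u_n ∈ 𝒞` be w-convergent with `sup_n ⟨A_n u_n, A_n u_n⟩_n < ∞`, and
let `u ∈ D(S)`. If `S_{n,β}(u_n, ψ_n) → S_β(u, ψ)` whenever `ψ_n ∈ 𝒞` s-converges to `ψ ∈ 𝒞`,
then `S_{n,β}(ψ_n, u_n) → S_β(ψ, u)` for every recovery sequence `ψ_n` of every `ψ ∈ D(S)`. -/
def FormDuality (F : Submodule ℝ (E →ₘ[mixture α ν] ℝ))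
    (T : ∀ n, ContractionSemigroup (Lp ℝ 2 (ν n))) : Prop :=
  ∀ β : ℝ, 0 < β → ∀ σ : ℕ → ℕ, IsSubseq σ →
    ∀ (us : ∀ k, Lp ℝ 2 (ν (σ k))) (u : Lp ℝ 2 (ν 0)),
    (∀ k, us k ∈ (T (σ k)).domain) →
    (∀ k, (T (σ k)).generator (us k) ∈ trace ν (classC ν F) (σ k)) →
    (∃ w, WConv F σ us w) → BddGenerators T σ us → u ∈ (T 0).domain →
    (∀ (ψs : ∀ k, Lp ℝ 2 (ν (σ k))) (ψ : Lp ℝ 2 (ν 0)),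
      ψ ∈ trace ν (classC ν F) 0 → SConv F σ ψs ψ →
      Tendsto (fun k => (T (σ k)).formShift β (us k) (ψs k)) atTop
        (𝓝 ((T 0).formShift β u ψ))) →
    ∀ (ψs : ∀ k, Lp ℝ 2 (ν (σ k))) (ψ : Lp ℝ 2 (ν 0)),
      ψ ∈ (T 0).domain → IsRecovery F T σ ψs ψ →
      Tendsto (fun k => (T (σ k)).formShift β (ψs k) (us k)) atTop
        (𝓝 ((T 0).formShift β ψ u))

/-- The forms `S_1, S_2, …` converge to `S = S_0` in the Mosco-type sense. -/
structure FormsConverge (F : Submodule ℝ (E →ₘ[mixture α ν] ℝ))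
    (T : ∀ n, ContractionSemigroup (Lp ℝ 2 (ν n))) : Prop where
  lowerBound : LowerBound F T
  hasRecovery : HasRecovery F T
  formDuality : FormDuality F T

end MoscoSeq

end

/-!
Read `ℱ` as a space of test elements with a norm-asymptotic map into each `L²(ν_n)`: this is
convergence of Hilbert spaces in the sense of Kuwae and Shioya, and w- and s-convergence become
weak and strong convergence tested against `ℱ`. Bounded sequences have weakly convergent
subsequences, the limit being an asymptotic centre.

For `f_n → f` strongly let `w` be a weak subsequential limit of `u_n = G_{n,β} f_n`, and let `ψ_n`
be a recovery sequence for `ψ ∈ D(S)`. Condition (iii) gives the limit of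
`S_{n,β}(u_n - ψ_n, u_n - ψ_n) = ⟨f_n, u_n - ψ_n⟩ - S_{n,β}(ψ_n, u_n) + S_{n,β}(ψ_n, ψ_n)`, and
condition (i) bounds it below by `S_β(w - ψ, w - ψ)`. Along the line `ψ = G_β f + t (w - G_β f)`,
`t ∈ ℝ`, this forces `w = G_β f`; then `ψ = w` makes the limit zero, so the convergence is strong.

Duality gives the weak convergence of `G'_{n,β} f_n`. For weakly convergent `f_n`, the resolvents of
test elements are recovery sequences, and (iii) identifies the weak limit of `G_{n,β} f_n`; duality
again gives the norms of `G'_{n,β} f_n` for strongly convergent `f_n`.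
-/

namespace ContractionSemigroup

variable {H : Type*} [NormedAddCommGroup H] [InnerProductSpace ℝ H]

section Generator

variable {T : ContractionSemigroup H} {u v : H}

theorem norm_op_apply_le (T : ContractionSemigroup H) (t : ℝ≥0) (x : H) : ‖T.op t x‖ ≤ ‖x‖ :=
  (ContinuousLinearMap.le_opNorm _ x).trans
    (mul_le_of_le_one_left (norm_nonneg x) (T.norm_op_le t))

theorem tendsto_generator (hu : u ∈ T.domain) :
    Tendsto (fun t : ℝ≥0 => t⁻¹ • (T.op t u - u)) (𝓝[>] 0) (𝓝 (T.generator u)) :=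
  tendsto_nhds_limUnder hu

theorem generator_eq (h : Tendsto (fun t : ℝ≥0 => t⁻¹ • (T.op t u - u)) (𝓝[>] 0) (𝓝 v)) :
    T.generator u = v :=
  h.limUnder_eq

theorem tendsto_generator_add (hu : u ∈ T.domain) (hv : v ∈ T.domain) :
    Tendsto (fun t : ℝ≥0 => t⁻¹ • (T.op t (u + v) - (u + v))) (𝓝[>] 0)
      (𝓝 (T.generator u + T.generator v)) := by
  refine ((tendsto_generator hu).add (tendsto_generator hv)).congr fun t => ?_
  rw [← smul_add, map_add, add_sub_add_comm]

theorem tendsto_generator_smul (c : ℝ) (hu : u ∈ T.domain) :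
    Tendsto (fun t : ℝ≥0 => t⁻¹ • (T.op t (c • u) - c • u)) (𝓝[>] 0)
      (𝓝 (c • T.generator u)) := by
  refine ((tendsto_generator hu).const_smul c).congr fun t => ?_
  rw [map_smul, ← smul_sub, smul_comm]

theorem add_mem_domain (hu : u ∈ T.domain) (hv : v ∈ T.domain) : u + v ∈ T.domain :=
  ⟨_, tendsto_generator_add hu hv⟩

theorem smul_mem_domain (c : ℝ) (hu : u ∈ T.domain) : c • u ∈ T.domain :=
  ⟨_, tendsto_generator_smul c hu⟩

theorem sub_mem_domain (hu : u ∈ T.domain) (hv : v ∈ T.domain) : u - v ∈ T.domain := by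
  rw [sub_eq_add_neg, ← neg_one_smul ℝ v]
  exact add_mem_domain hu (smul_mem_domain _ hv)

theorem generator_add (hu : u ∈ T.domain) (hv : v ∈ T.domain) :
    T.generator (u + v) = T.generator u + T.generator v :=
  generator_eq (tendsto_generator_add hu hv)

theorem generator_smul (c : ℝ) (hu : u ∈ T.domain) :
    T.generator (c • u) = c • T.generator u :=
  generator_eq (tendsto_generator_smul c hu)

theorem generator_sub (hu : u ∈ T.domain) (hv : v ∈ T.domain) :
    T.generator (u - v) = T.generator u - T.generator v := by
  rw [sub_eq_add_neg, ← neg_one_smul ℝ v, generator_add hu (smul_mem_domain _ hv),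
    generator_smul _ hv, neg_one_smul, ← sub_eq_add_neg]

end Generator

section Form

variable {T : ContractionSemigroup H} {β : ℝ} {u v w : H}

theorem form_self_nonneg (hu : u ∈ T.domain) : 0 ≤ T.form u u := by
  rw [form, neg_nonneg]
  refine le_of_tendsto ((tendsto_generator hu).inner (𝕜 := ℝ) tendsto_const_nhds)
    (Eventually.of_forall fun t => ?_)
  have inner_op_le : inner ℝ (T.op t u) u ≤ ‖u‖ * ‖u‖ :=
    (real_inner_le_norm _ _).trans
      (mul_le_mul_of_nonneg_right (T.norm_op_apply_le t u) (norm_nonneg u))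
  rw [NNReal.smul_def, real_inner_smul_left, inner_sub_left, real_inner_self_eq_norm_mul_norm]
  exact mul_nonpos_of_nonneg_of_nonpos (NNReal.coe_nonneg _) (sub_nonpos.2 inner_op_le)

theorem formShift_self : T.formShift β u u = β * ‖u‖ ^ 2 + T.form u u := by
  rw [formShift, real_inner_self_eq_norm_sq]

theorem mul_norm_sq_le_formShift_self (hu : u ∈ T.domain) :
    β * ‖u‖ ^ 2 ≤ T.formShift β u u := by
  rw [formShift_self]
  exact le_add_of_nonneg_right (form_self_nonneg hu)

theorem formShift_add_left (hu : u ∈ T.domain) (hv : v ∈ T.domain) :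
    T.formShift β (u + v) w = T.formShift β u w + T.formShift β v w := by
  simp only [formShift, form, generator_add hu hv, inner_add_left]
  ring

theorem formShift_smul_left (c : ℝ) (hu : u ∈ T.domain) :
    T.formShift β (c • u) w = c * T.formShift β u w := by
  simp only [formShift, form, generator_smul c hu, real_inner_smul_left]
  ring

theorem formShift_sub_left (hu : u ∈ T.domain) (hv : v ∈ T.domain) :
    T.formShift β (u - v) w = T.formShift β u w - T.formShift β v w := by
  simp only [formShift, form, generator_sub hu hv, inner_sub_left]
  ring

theorem formShift_smul_right (c : ℝ) : T.formShift β u (c • v) = c * T.formShift β u v := by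
  simp only [formShift, form, real_inner_smul_right]
  ring

theorem formShift_sub_right :
    T.formShift β u (v - w) = T.formShift β u v - T.formShift β u w := by
  simp only [formShift, form, inner_sub_right]
  ring

end Form

section Continuity

theorem norm_op_sub_op_le (T : ContractionSemigroup H) (s t : ℝ≥0) (x : H) :
    ‖T.op s x - T.op t x‖ ≤ ‖T.op (nndist s t) x - x‖ := by
  wlog hst : s ≤ t generalizing s t
  · rw [norm_sub_rev, nndist_comm]
    exact this t s (le_of_not_ge hst)
  obtain ⟨d, rfl⟩ := exists_add_of_le hst
  have nndist_eq : nndist s (s + d) = d := by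
    rw [NNReal.nndist_eq, add_tsub_cancel_left, tsub_eq_zero_of_le hst]
    simp
  rw [nndist_eq, T.op_add, ContinuousLinearMap.comp_apply, ← map_sub]
  exact (T.norm_op_apply_le s _).trans_eq (norm_sub_rev _ _)

theorem continuous_op_apply (T : ContractionSemigroup H) (x : H) :
    Continuous fun t => T.op t x := by
  refine continuous_iff_continuousAt.2 fun t => tendsto_iff_norm_sub_tendsto_zero.2 ?_
  refine squeeze_zero (fun _ => norm_nonneg _) (fun s => T.norm_op_sub_op_le s t x) ?_
  have tendsto_nndist : Tendsto (fun s : ℝ≥0 => nndist s t) (𝓝 t) (𝓝 0) := by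
    simpa using (continuous_id.nndist (continuous_const (y := t))).tendsto t
  exact tendsto_iff_norm_sub_tendsto_zero.1 ((T.tendsto_op x).comp tendsto_nndist)

end Continuity

section Resolvent

/-- The integrand `e^{-β t} T_t f` of the resolvent, as a function of `t ∈ ℝ`; at negative times
`T_t` is read as `T_0`. -/
noncomputable def laplaceIntegrand (T : ContractionSemigroup H) (β : ℝ) (f : H) (t : ℝ) : H :=
  Real.exp (-(β * t)) • T.op t.toNNReal f

theorem continuous_laplaceIntegrand (T : ContractionSemigroup H) (β : ℝ) (f : H) :
    Continuous (T.laplaceIntegrand β f) :=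
  (by fun_prop : Continuous fun t : ℝ => Real.exp (-(β * t))).smul
    ((T.continuous_op_apply f).comp continuous_real_toNNReal)

theorem integrableOn_laplaceIntegrand (T : ContractionSemigroup H) {β : ℝ} (hβ : 0 < β) (f : H)
    (a : ℝ) : IntegrableOn (T.laplaceIntegrand β f) (Set.Ioi a) := by
  refine Integrable.mono' ((exp_neg_integrableOn_Ioi a hβ).mul_const ‖f‖)
    (T.continuous_laplaceIntegrand β f).aestronglyMeasurable.restrict
    (Eventually.of_forall fun t => ?_)
  rw [laplaceIntegrand, norm_smul, Real.norm_eq_abs, Real.abs_exp, neg_mul]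
  exact mul_le_mul_of_nonneg_left (T.norm_op_apply_le _ f) (Real.exp_nonneg _)

theorem resolvent_eq_integral (T : ContractionSemigroup H) (β : ℝ) (f : H) :
    T.resolvent β f = ∫ t in Set.Ioi (0 : ℝ), T.laplaceIntegrand β f t :=
  rfl

theorem integral_Ioi_laplaceIntegrand (T : ContractionSemigroup H) {β : ℝ} (hβ : 0 < β) (f : H)
    (h : ℝ) : ∫ t in Set.Ioi h, T.laplaceIntegrand β f t =
      T.resolvent β f - ∫ t in (0 : ℝ)..h, T.laplaceIntegrand β f t :=
  eq_sub_of_add_eq' (intervalIntegral.integral_interval_add_Ioi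
    (T.integrableOn_laplaceIntegrand hβ f 0) (T.integrableOn_laplaceIntegrand hβ f h))

variable [CompleteSpace H]

theorem op_resolvent (T : ContractionSemigroup H) {β : ℝ} (hβ : 0 < β) (f : H) (h : ℝ≥0) :
    T.op h (T.resolvent β f) =
      Real.exp (β * h) • (T.resolvent β f - ∫ t in (0 : ℝ)..h, T.laplaceIntegrand β f t) := by
  have integral_shift : ∫ t in Set.Ioi (h : ℝ), T.laplaceIntegrand β f t =
      ∫ t in Set.Ioi (0 : ℝ), T.laplaceIntegrand β f (t + h) := by
    rw [← (measurePreserving_add_right volume (h : ℝ)).setIntegral_preimage_emb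
      (measurableEmbedding_addRight (h : ℝ))]
    simp
  rw [← T.integral_Ioi_laplaceIntegrand hβ, integral_shift, ← integral_smul,
    resolvent_eq_integral,
    ← ContinuousLinearMap.integral_comp_comm _ (T.integrableOn_laplaceIntegrand hβ f 0)]
  refine setIntegral_congr_fun measurableSet_Ioi fun t ht => ?_
  simp only [laplaceIntegrand]
  rw [map_smul, smul_smul, ← Real.exp_add, add_comm t, Real.toNNReal_add h.coe_nonneg (le_of_lt ht),
    Real.toNNReal_coe, T.op_add, ContinuousLinearMap.comp_apply]
  congr 2
  ring

/-- Differentiate the formula of `op_resolvent` at `0`. -/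
theorem tendsto_generator_resolvent (T : ContractionSemigroup H) {β : ℝ} (hβ : 0 < β) (f : H) :
    Tendsto (fun t : ℝ≥0 => t⁻¹ • (T.op t (T.resolvent β f) - T.resolvent β f)) (𝓝[>] 0)
      (𝓝 (β • T.resolvent β f - f)) := by
  have integrand_zero : T.laplaceIntegrand β f 0 = f := by simp [laplaceIntegrand, T.op_zero]
  have hasDerivAt_integral : HasDerivAt (fun h : ℝ => ∫ t in (0 : ℝ)..h, T.laplaceIntegrand β f t)
      f 0 := by
    simpa only [integrand_zero] using
      ((T.continuous_laplaceIntegrand β f).integral_hasStrictDerivAt 0 0).hasDerivAt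
  have hasDerivAt_exp : HasDerivAt (fun h : ℝ => Real.exp (β * h)) β 0 := by
    simpa using ((hasDerivAt_id (0 : ℝ)).const_mul β).exp
  have tendsto_coe : Tendsto ((↑) : ℝ≥0 → ℝ) (𝓝[>] 0) (𝓝[>] 0) :=
    tendsto_nhdsWithin_iff.2 ⟨(NNReal.continuous_coe.tendsto 0).mono_left nhdsWithin_le_nhds,
      eventually_nhdsWithin_of_forall fun _ ht => NNReal.coe_pos.2 ht⟩
  have tendsto_slope := (hasDerivAt_exp.smul
    (hasDerivAt_integral.const_sub (T.resolvent β f))).tendsto_slope_zero_right.comp tendsto_coe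
  simp only [intervalIntegral.integral_same, mul_zero, Real.exp_zero, one_smul, sub_zero,
    zero_add] at tendsto_slope
  rw [sub_eq_neg_add]
  refine tendsto_slope.congr fun t => ?_
  simp [T.op_resolvent hβ, NNReal.smul_def]

theorem resolvent_mem_domain (T : ContractionSemigroup H) {β : ℝ} (hβ : 0 < β) (f : H) :
    T.resolvent β f ∈ T.domain :=
  ⟨_, T.tendsto_generator_resolvent hβ f⟩

theorem generator_resolvent (T : ContractionSemigroup H) {β : ℝ} (hβ : 0 < β) (f : H) :
    T.generator (T.resolvent β f) = β • T.resolvent β f - f :=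
  generator_eq (T.tendsto_generator_resolvent hβ f)

theorem formShift_resolvent (T : ContractionSemigroup H) {β : ℝ} (hβ : 0 < β) (f v : H) :
    T.formShift β (T.resolvent β f) v = inner ℝ f v := by
  rw [formShift, form, T.generator_resolvent hβ, inner_sub_left, real_inner_smul_left]
  ring

theorem form_resolvent_self (T : ContractionSemigroup H) {β : ℝ} (hβ : 0 < β) (f : H) :
    T.form (T.resolvent β f) (T.resolvent β f) =
      inner ℝ f (T.resolvent β f) - β * ‖T.resolvent β f‖ ^ 2 := by
  rw [← T.formShift_resolvent hβ, formShift_self, add_sub_cancel_left]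

theorem norm_resolvent_le (T : ContractionSemigroup H) {β : ℝ} (hβ : 0 < β) (f : H) :
    ‖T.resolvent β f‖ ≤ β⁻¹ * ‖f‖ := by
  have coercive : β * ‖T.resolvent β f‖ ^ 2 ≤ ‖f‖ * ‖T.resolvent β f‖ :=
    calc β * ‖T.resolvent β f‖ ^ 2
        ≤ T.formShift β (T.resolvent β f) (T.resolvent β f) :=
          mul_norm_sq_le_formShift_self (T.resolvent_mem_domain hβ f)
      _ = inner ℝ f (T.resolvent β f) := T.formShift_resolvent hβ f _
      _ ≤ ‖f‖ * ‖T.resolvent β f‖ := real_inner_le_norm _ _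
  rw [← div_eq_inv_mul, le_div_iff₀ hβ]
  rcases (norm_nonneg (T.resolvent β f)).eq_or_lt with norm_zero | norm_pos
  · simp [← norm_zero]
  · nlinarith

theorem norm_generator_resolvent_le (T : ContractionSemigroup H) {β : ℝ} (hβ : 0 < β) (f : H) :
    ‖T.generator (T.resolvent β f)‖ ≤ 2 * ‖f‖ := by
  have norm_smul_le : ‖β • T.resolvent β f‖ ≤ ‖f‖ := by
    rw [norm_smul, Real.norm_of_nonneg hβ.le, ← le_inv_mul_iff₀ hβ]
    exact T.norm_resolvent_le hβ f
  rw [T.generator_resolvent hβ, two_mul]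
  exact (norm_sub_le _ _).trans (add_le_add_left norm_smul_le _)

theorem inner_dual_resolvent (T : ContractionSemigroup H) {β : ℝ} (hβ : 0 < β) (f g : H) :
    inner ℝ (T.dual.resolvent β f) g = inner ℝ f (T.resolvent β g) := by
  rw [real_inner_comm, resolvent_eq_integral, resolvent_eq_integral,
    ← integral_inner (T.dual.integrableOn_laplaceIntegrand hβ f 0),
    ← integral_inner (T.integrableOn_laplaceIntegrand hβ g 0)]
  refine integral_congr_ae (Eventually.of_forall fun t => ?_)
  simp only [laplaceIntegrand, dual, real_inner_smul_right]
  rw [ContinuousLinearMap.adjoint_inner_right, real_inner_comm]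

/-- Apply the hypothesis to `ψ = G_β f + t (w - G_β f)` and let `t → -∞`. -/
theorem eq_resolvent_of_forall_formShift_le (T : ContractionSemigroup H) {β : ℝ} (hβ : 0 < β)
    {f w : H} (hw : w ∈ T.domain)
    (h : ∀ ψ ∈ T.domain, T.formShift β (w - ψ) (w - ψ) ≤
      inner ℝ f (w - ψ) - (T.formShift β ψ (T.resolvent β f) - T.formShift β ψ ψ)) :
    w = T.resolvent β f := by
  set G := T.resolvent β f with hG
  have hG_mem : G ∈ T.domain := T.resolvent_mem_domain hβ f
  have hη : w - G ∈ T.domain := sub_mem_domain hw hG_mem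
  set η := w - G with hη_def
  have line (t : ℝ) : (1 - 2 * t) * T.formShift β η η ≤ T.formShift β G η := by
    have hψ := h (G + t • η) (add_mem_domain hG_mem (smul_mem_domain t hη))
    have sub_line : w - (G + t • η) = (1 - t) • η := by
      rw [sub_smul, one_smul, hη_def]
      abel
    have line_sub : T.formShift β (G + t • η) G - T.formShift β (G + t • η) (G + t • η) =
        -(t * (T.formShift β G η + t * T.formShift β η η)) := by
      rw [← formShift_sub_right, sub_add_cancel_left, ← neg_smul, formShift_smul_right,
        formShift_add_left hG_mem (smul_mem_domain t hη), formShift_smul_left t hη]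
      ring
    rw [sub_line, line_sub, ← T.formShift_resolvent hβ, ← hG, formShift_smul_left _ hη,
      formShift_smul_right, formShift_smul_right] at hψ
    linarith
  have form_η_nonpos : T.formShift β η η ≤ 0 := by
    by_contra! hpos
    have := line (-T.formShift β G η / (2 * T.formShift β η η))
    have expand : (1 - 2 * (-T.formShift β G η / (2 * T.formShift β η η))) * T.formShift β η η =
        T.formShift β η η + T.formShift β G η := by
      field_simp
      ring
    linarith
  have norm_η_nonpos : ‖η‖ ^ 2 ≤ 0 :=
    nonpos_of_mul_nonpos_right ((mul_norm_sq_le_formShift_self hη).trans form_η_nonpos) hβ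
  exact sub_eq_zero.1 (norm_eq_zero.1 (pow_eq_zero_iff two_ne_zero |>.1
    (le_antisymm norm_η_nonpos (sq_nonneg _))))

end Resolvent

end ContractionSemigroup

namespace MoscoSeq

variable {σ τ : ℕ → ℕ}

theorem isSubseq_succ : IsSubseq fun k => k + 1 :=
  ⟨strictMono_id.add_const 1, fun k => Nat.le_add_left 1 k⟩

theorem IsSubseq.comp (hσ : IsSubseq σ) (hτ : StrictMono τ) : IsSubseq (σ ∘ τ) :=
  ⟨hσ.1.comp hτ, fun k => hσ.2 (τ k)⟩

theorem IsSubseq.tendsto (hσ : IsSubseq σ) : Tendsto σ atTop atTop :=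
  hσ.1.tendsto_atTop

theorem IsSubseq.exists_eq_succ (hσ : IsSubseq σ) :
    ∃ τ : ℕ → ℕ, StrictMono τ ∧ σ = (fun k => k + 1) ∘ τ :=
  ⟨fun k => σ k - 1, fun _ _ h => Nat.sub_lt_sub_right (hσ.2 _) (hσ.1 h),
    funext fun k => (Nat.sub_add_cancel (hσ.2 k)).symm⟩

end MoscoSeq

namespace VaryingHilbert

open MoscoSeq (IsSubseq)

section Order

/-- The Brézis–Browder ordering principle. -/
theorem exists_le_forall_le_eq {P : Type*} [Preorder P] {r : P → ℝ} (hr : Monotone r)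
    (hr_bdd : BddBelow (Set.range r))
    (hP : ∀ q : ℕ → P, Antitone q → BddBelow (Set.range q)) (p : P) :
    ∃ q ≤ p, ∀ q' ≤ q, r q' = r q := by
  have exists_almost_min (n : ℕ) (q : P) :
      ∃ q' ≤ q, ∀ q'' ≤ q, r q' ≤ r q'' + 1 / ((n : ℝ) + 1) := by
    have bdd : BddBelow (r '' Set.Iic q) := hr_bdd.mono (Set.image_subset_range r _)
    obtain ⟨_, ⟨q', hq', rfl⟩, hlt⟩ := exists_lt_of_csInf_lt ((Set.nonempty_Iic (a := q)).image r)
      (lt_add_of_pos_right _ (Nat.one_div_pos_of_nat (n := n)))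
    refine ⟨q', hq', fun q'' hq'' => hlt.le.trans ?_⟩
    gcongr
    exact csInf_le bdd (Set.mem_image_of_mem r hq'')
  choose next next_le next_min using exists_almost_min
  let q : ℕ → P := fun n => Nat.rec p next n
  obtain ⟨q_inf, hq_inf⟩ := hP q (antitone_nat_of_succ_le fun n => next_le n (q n))
  have q_inf_le (n : ℕ) : q_inf ≤ q n := hq_inf (Set.mem_range_self n)
  refine ⟨q_inf, q_inf_le 0, fun q' hq' => (hr hq').antisymm ?_⟩
  refine ge_of_tendsto' (by simpa using tendsto_one_div_add_atTop_nhds_zero_nat.const_add (r q'))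
    fun n => ?_
  rw [← one_div]
  exact (hr (q_inf_le (n + 1))).trans (next_min n (q n) q' (hq'.trans (q_inf_le n)))

theorem exists_filter_le_forall_le_eq {ι : Type*} {r : Filter ι → ℝ} (hr : Monotone r)
    (hr_bdd : BddBelow (Set.range r)) (l₀ : Filter ι) [l₀.NeBot] [l₀.IsCountablyGenerated] :
    ∃ l ≤ l₀, l.NeBot ∧ l.IsCountablyGenerated ∧
      ∀ l' ≤ l, l'.NeBot → l'.IsCountablyGenerated → r l' = r l := by
  have := nonempty_of_neBot l₀
  let P := {l : Filter ι // l.NeBot ∧ l.IsCountablyGenerated}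
  have bddBelow_antitone (q : ℕ → P) (hq : Antitone q) : BddBelow (Set.range q) := by
    have := fun n => (q n).2.1
    have := fun n => (q n).2.2
    have directed : Directed (· ≥ ·) fun n => (q n : Filter ι) :=
      directed_of_isDirected_le fun _ _ h => hq h
    exact ⟨⟨⨅ n, q n, iInf_neBot_of_directed directed inferInstance, inferInstance⟩,
      Set.forall_mem_range.2 fun n => iInf_le (fun n => (q n : Filter ι)) n⟩
  obtain ⟨⟨l, hl_neBot, hl_gen⟩, hl, minimal⟩ := exists_le_forall_le_eq
    (hr.comp (Subtype.mono_coe _)) (hr_bdd.mono (Set.range_comp_subset_range _ r))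
    bddBelow_antitone ⟨l₀, inferInstance, inferInstance⟩
  exact ⟨l, hl, hl_neBot, hl_gen, fun l' hl' h₁ h₂ => minimal ⟨l', h₁, h₂⟩ hl'⟩

end Order

theorem tendsto_of_forall_exists_approx {ι : Type*} {l : Filter ι} {b : ι → ℝ} {y : ℝ}
    (h : ∀ ε > 0, ∃ (b' : ι → ℝ) (y' : ℝ), Tendsto b' l (𝓝 y') ∧ |y - y'| < ε ∧
      ∀ᶠ k in l, |b k - b' k| < ε) :
    Tendsto b l (𝓝 y) := by
  refine Metric.tendsto_nhds.2 fun ε hε => ?_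
  obtain ⟨b', y', tendsto_b', limit_close, eventually_close⟩ := h (ε / 3) (by positivity)
  filter_upwards [eventually_close, Metric.tendsto_nhds.1 tendsto_b' (ε / 3) (by positivity)]
    with k hk hk'
  calc dist (b k) y ≤ dist (b k) (b' k) + dist (b' k) y' + dist y' y := dist_triangle4 _ _ _ _
    _ < ε / 3 + ε / 3 + ε / 3 := add_lt_add (add_lt_add hk hk') (by rwa [dist_comm])
    _ = ε := by ring

theorem exists_extension {H : ℕ → Type*} [∀ n, Zero (H n)] {σ : ℕ → ℕ}
    (hσ : StrictMono σ) (φ : ∀ k, H (σ k)) :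
    ∃ s : ∀ n, H n, (∀ k, s (σ k) = φ k) ∧ ∀ n, n ∉ Set.range σ → s n = 0 := by
  have exists_value (n : ℕ) : ∃ x : H n, (∀ k, σ k = n → HEq x (φ k)) ∧
      (n ∉ Set.range σ → x = 0) := by
    by_cases hn : n ∈ Set.range σ
    · obtain ⟨k, rfl⟩ := hn
      exact ⟨φ k, fun j hj => by rw [hσ.injective hj], fun hk => absurd ⟨k, rfl⟩ hk⟩
    · exact ⟨0, fun k hk => absurd ⟨k, hk⟩ hn, fun _ => rfl⟩
  choose s hs hs_zero using exists_value
  exact ⟨s, fun k => eq_of_heq (hs _ k rfl), hs_zero⟩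

theorem tendsto_norm_of_tendsto_extension {H : ℕ → Type*} [∀ n, NormedAddCommGroup (H n)]
    {ρ : ℕ → ℕ} (hρ : StrictMono ρ) {s : ∀ n, H n} (hs : Tendsto (fun n => ‖s (ρ n)‖) atTop (𝓝 0))
    (hs_zero : ∀ n, n ∉ Set.range ρ → s n = 0) :
    Tendsto (fun n => ‖s n‖) atTop (𝓝 0) := by
  refine Metric.tendsto_atTop.2 fun ε hε => ?_
  obtain ⟨N, hN⟩ := Metric.tendsto_atTop.1 hs ε hε
  refine ⟨ρ N, fun n hn => ?_⟩
  by_cases hnρ : n ∈ Set.range ρ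
  · obtain ⟨j, rfl⟩ := hnρ
    exact hN j (hρ.le_iff_le.1 hn)
  · rwa [hs_zero n hnρ, norm_zero, dist_self]

variable {H : ℕ → Type*} [∀ n, NormedAddCommGroup (H n)] [∀ n, InnerProductSpace ℝ (H n)]
  {V : Type*} [AddCommGroup V] [Module ℝ V]

/-- Convergence of the Hilbert spaces `H n` to `H 0` in the sense of Kuwae and Shioya: the space
`V` of test elements has dense image in `H 0`, and the norms of the images of a test element in
`H n` converge to the norm of its image in `H 0`. -/
structure ConvergesVia (Φ : ∀ n, V →ₗ[ℝ] H n) : Prop where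
  denseRange : DenseRange (Φ 0)
  tendsto_norm : ∀ v, Tendsto (fun n => ‖Φ n v‖) atTop (𝓝 ‖Φ 0 v‖)

/-- Weak convergence, along the indices `n = σ k`: the sequence is bounded and its inner products
with the images of every test element converge. -/
structure WeakLim (Φ : ∀ n, V →ₗ[ℝ] H n) (σ : ℕ → ℕ) (φ : ∀ k, H (σ k)) (f : H 0) : Prop where
  exists_norm_le : ∃ M, ∀ k, ‖φ k‖ ≤ M
  tendsto_inner_apply : ∀ v, Tendsto (fun k => inner ℝ (φ k) (Φ (σ k) v)) atTop
    (𝓝 (inner ℝ f (Φ 0 v)))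

/-- Strong convergence, along the indices `n = σ k`. -/
structure StrongLim (Φ : ∀ n, V →ₗ[ℝ] H n) (σ : ℕ → ℕ) (φ : ∀ k, H (σ k)) (f : H 0) : Prop where
  tendsto_inner_apply : ∀ v, Tendsto (fun k => inner ℝ (φ k) (Φ (σ k) v)) atTop
    (𝓝 (inner ℝ f (Φ 0 v)))
  tendsto_norm : Tendsto (fun k => ‖φ k‖) atTop (𝓝 ‖f‖)

variable {Φ : ∀ n, V →ₗ[ℝ] H n} {σ τ : ℕ → ℕ} {φ ψ : ∀ k, H (σ k)} {f g : H 0}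

theorem ConvergesVia.tendsto_inner (hΦ : ConvergesVia Φ) (v w : V) :
    Tendsto (fun n => inner ℝ (Φ n v) (Φ n w)) atTop (𝓝 (inner ℝ (Φ 0 v) (Φ 0 w))) := by
  simp_rw [real_inner_eq_norm_add_mul_self_sub_norm_mul_self_sub_norm_mul_self_div_two, ← map_add,
    ← pow_two]
  exact ((((hΦ.tendsto_norm _).pow 2).sub ((hΦ.tendsto_norm _).pow 2)).sub
    ((hΦ.tendsto_norm _).pow 2)).div_const 2

theorem ConvergesVia.strongLim (hΦ : ConvergesVia Φ) (hσ : Tendsto σ atTop atTop) (v : V) :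
    StrongLim Φ σ (fun k => Φ (σ k) v) (Φ 0 v) :=
  ⟨fun w => (hΦ.tendsto_inner v w).comp hσ, (hΦ.tendsto_norm v).comp hσ⟩

theorem StrongLim.weakLim (h : StrongLim Φ σ φ f) : WeakLim Φ σ φ f := by
  obtain ⟨M, hM⟩ := h.tendsto_norm.bddAbove_range
  exact ⟨⟨M, fun k => hM (Set.mem_range_self k)⟩, h.tendsto_inner_apply⟩

theorem ConvergesVia.strongLim_zero (hΦ : ConvergesVia Φ) (hσ : Tendsto σ atTop atTop)
    (hφ : Tendsto (fun k => ‖φ k‖) atTop (𝓝 0)) : StrongLim Φ σ φ 0 := by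
  refine ⟨fun v => ?_, by rwa [norm_zero]⟩
  rw [inner_zero_left]
  refine squeeze_zero_norm (fun k => abs_real_inner_le_norm _ _) ?_
  simpa using hφ.mul ((hΦ.tendsto_norm v).comp hσ)

theorem WeakLim.sub (hφ : WeakLim Φ σ φ f) (hψ : WeakLim Φ σ ψ g) :
    WeakLim Φ σ (fun k => φ k - ψ k) (f - g) := by
  obtain ⟨M, hM⟩ := hφ.exists_norm_le
  obtain ⟨N, hN⟩ := hψ.exists_norm_le
  refine ⟨⟨M + N, fun k => (norm_sub_le _ _).trans (add_le_add (hM k) (hN k))⟩, fun v => ?_⟩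
  simpa only [inner_sub_left] using (hφ.tendsto_inner_apply v).sub (hψ.tendsto_inner_apply v)

theorem WeakLim.comp (h : WeakLim Φ σ φ f) (hτ : StrictMono τ) :
    WeakLim Φ (σ ∘ τ) (fun k => φ (τ k)) f :=
  ⟨h.exists_norm_le.imp fun _ hM k => hM (τ k),
    fun v => (h.tendsto_inner_apply v).comp hτ.tendsto_atTop⟩

theorem StrongLim.comp (h : StrongLim Φ σ φ f) (hτ : StrictMono τ) :
    StrongLim Φ (σ ∘ τ) (fun k => φ (τ k)) f :=
  ⟨fun v => (h.tendsto_inner_apply v).comp hτ.tendsto_atTop,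
    h.tendsto_norm.comp hτ.tendsto_atTop⟩

theorem StrongLim.tendsto_norm_sub_apply (h : StrongLim Φ σ φ f) (hΦ : ConvergesVia Φ)
    (hσ : Tendsto σ atTop atTop) (v : V) :
    Tendsto (fun k => ‖φ k - Φ (σ k) v‖) atTop (𝓝 ‖f - Φ 0 v‖) := by
  have tendsto_sq : Tendsto (fun k => ‖φ k - Φ (σ k) v‖ ^ 2) atTop (𝓝 (‖f - Φ 0 v‖ ^ 2)) := by
    simp_rw [norm_sub_sq_real]
    exact ((h.tendsto_norm.pow 2).sub ((h.tendsto_inner_apply v).const_mul 2)).add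
      (((hΦ.tendsto_norm v).comp hσ).pow 2)
  simpa only [Real.sqrt_sq (norm_nonneg _)] using tendsto_sq.sqrt

theorem ConvergesVia.exists_norm_sub_lt (hΦ : ConvergesVia Φ) (f : H 0) {ε : ℝ} (hε : 0 < ε) :
    ∃ v, ‖f - Φ 0 v‖ < ε := by
  simpa only [dist_eq_norm] using hΦ.denseRange.exists_dist_lt f hε

theorem WeakLim.tendsto_inner (hφ : WeakLim Φ σ φ f) (hψ : StrongLim Φ σ ψ g)
    (hΦ : ConvergesVia Φ) (hσ : Tendsto σ atTop atTop) :
    Tendsto (fun k => inner ℝ (φ k) (ψ k)) atTop (𝓝 (inner ℝ f g)) := by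
  obtain ⟨M, hM⟩ := hφ.exists_norm_le
  have hM_nonneg : 0 ≤ M := (norm_nonneg _).trans (hM 0)
  refine tendsto_of_forall_exists_approx fun ε hε => ?_
  obtain ⟨v, hv⟩ : ∃ v, (M + ‖f‖ + 1) * ‖g - Φ 0 v‖ < ε := by
    simpa only [lt_div_iff₀' (show 0 < M + ‖f‖ + 1 by positivity)] using
      hΦ.exists_norm_sub_lt g (show 0 < ε / (M + ‖f‖ + 1) by positivity)
  refine ⟨_, _, hφ.tendsto_inner_apply v, ?_, ?_⟩
  · rw [← inner_sub_right]
    refine (abs_real_inner_le_norm _ _).trans_lt (lt_of_le_of_lt ?_ hv)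
    gcongr
    linarith
  · filter_upwards [((hψ.tendsto_norm_sub_apply hΦ hσ v).const_mul _).eventually_lt_const hv]
      with k hk
    rw [← inner_sub_right]
    refine (abs_real_inner_le_norm _ _).trans_lt (lt_of_le_of_lt ?_ hk)
    gcongr
    linarith [hM k, norm_nonneg f]

section Compactness

/-- `ρ` is the squared asymptotic radius of the sequence `φ k ∈ H (σ k)` along the filter `l`, in
the strong sense that no refinement of `l` has a smaller one: centres `v` come within squared
distance `c` of `φ` for each `c > ρ`, and none does for `c < ρ`, not even along a subsequence. -/
structure IsAsympRadius (Φ : ∀ n, V →ₗ[ℝ] H n) (σ : ℕ → ℕ) (φ : ∀ k, H (σ k)) (l : Filter ℕ)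
    (ρ : ℝ) : Prop where
  exists_center : ∀ c > ρ, ∃ v, ∀ᶠ k in l, ‖φ k - Φ (σ k) v‖ ^ 2 < c
  eventually_le : ∀ c < ρ, ∀ v, ∀ᶠ k in l, c ≤ ‖φ k - Φ (σ k) v‖ ^ 2

theorem exists_isAsympRadius (hφ : ∃ M, ∀ k, ‖φ k‖ ≤ M) :
    ∃ l ≤ atTop, l.NeBot ∧ l.IsCountablyGenerated ∧ ∃ ρ, IsAsympRadius Φ σ φ l ρ := by
  obtain ⟨M, hM⟩ := hφ
  let levels (l : Filter ℕ) : Set ℝ := {c | 0 ≤ c ∧ ∃ v, ∀ᶠ k in l, ‖φ k - Φ (σ k) v‖ ^ 2 < c}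
  have bddBelow_levels (l : Filter ℕ) : BddBelow (levels l) := ⟨0, fun _ hc => hc.1⟩
  have levels_nonempty (l : Filter ℕ) : (levels l).Nonempty :=
    ⟨M ^ 2 + 1, by positivity, 0, Eventually.of_forall fun k => by
      simpa using (pow_le_pow_left₀ (norm_nonneg _) (hM k) 2).trans_lt (lt_add_one _)⟩
  have levels_anti {l l' : Filter ℕ} (h : l ≤ l') : levels l' ⊆ levels l :=
    fun _ ⟨hc, v, hv⟩ => ⟨hc, v, hv.filter_mono h⟩
  obtain ⟨l, hl, hl_neBot, hl_gen, minimal⟩ := exists_filter_le_forall_le_eq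
    (r := fun l => sInf (levels l))
    (fun l l' h => csInf_le_csInf (bddBelow_levels _) (levels_nonempty _) (levels_anti h))
    ⟨0, Set.forall_mem_range.2 fun l => le_csInf (levels_nonempty _) fun _ hc => hc.1⟩ atTop
  refine ⟨l, hl, hl_neBot, hl_gen, sInf (levels l), fun c hc => ?_, fun c hc v => ?_⟩
  · obtain ⟨c', ⟨-, v, hv⟩, hc'⟩ := exists_lt_of_csInf_lt (levels_nonempty l) hc
    exact ⟨v, hv.mono fun k hk => hk.trans hc'⟩
  · by_contra frequently_lt
    simp only [not_eventually, not_le] at frequently_lt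
    let l' := l ⊓ 𝓟 {k | ‖φ k - Φ (σ k) v‖ ^ 2 < c}
    have c_mem : c ∈ levels l' :=
      ⟨(sq_nonneg _).trans frequently_lt.exists.choose_spec.le, v,
        mem_inf_of_right (mem_principal_self _)⟩
    refine hc.not_ge ?_
    rw [← minimal l' inf_le_left (frequently_mem_iff_neBot.1 frequently_lt) inferInstance]
    exact csInf_le (bddBelow_levels _) c_mem

variable {l : Filter ℕ} {ρ ε : ℝ} {v w : V}

theorem IsAsympRadius.norm_sub_center_le [l.NeBot] (h : IsAsympRadius Φ σ φ l ρ)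
    (hΦ : ConvergesVia Φ) (hσ : Tendsto σ l atTop) (hε : 0 < ε)
    (hv : ∀ᶠ k in l, ‖φ k - Φ (σ k) v‖ ^ 2 < ρ + ε ^ 2)
    (hw : ∀ᶠ k in l, ‖φ k - Φ (σ k) w‖ ^ 2 < ρ + ε ^ 2) : ‖Φ 0 v - Φ 0 w‖ ≤ 3 * ε := by
  have eventually_sq_le : ∀ᶠ k in l, ‖Φ (σ k) (v - w)‖ ^ 2 ≤ (3 * ε) ^ 2 := by
    have le_midpoint := h.eventually_le (ρ - ε ^ 2) (sub_lt_self _ (by positivity))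
      ((2 : ℝ)⁻¹ • (v + w))
    filter_upwards [hv, hw, le_midpoint] with k hkv hkw hk
    have parallelogram := parallelogram_law_with_norm ℝ (φ k - Φ (σ k) v) (φ k - Φ (σ k) w)
    have add_eq : φ k - Φ (σ k) v + (φ k - Φ (σ k) w) =
        (2 : ℝ) • (φ k - Φ (σ k) ((2 : ℝ)⁻¹ • (v + w))) := by
      rw [smul_sub, map_smul, smul_inv_smul₀ two_ne_zero, map_add, two_smul]
      abel
    rw [add_eq, norm_smul, Real.norm_two, sub_sub_sub_cancel_left, norm_sub_rev (Φ (σ k) w),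
      ← map_sub] at parallelogram
    nlinarith
  rw [← map_sub]
  exact le_of_tendsto ((hΦ.tendsto_norm (v - w)).comp hσ)
    (eventually_sq_le.mono fun k hk => (sq_le_sq₀ (norm_nonneg _) (by positivity)).1 hk)

theorem IsAsympRadius.abs_inner_le (h : IsAsympRadius Φ σ φ l ρ)
    (hΦ : ConvergesVia Φ) (hσ : Tendsto σ l atTop) (hε : 0 < ε)
    (hv : ∀ᶠ k in l, ‖φ k - Φ (σ k) v‖ ^ 2 < ρ + ε ^ 2) (w : V) :
    ∀ᶠ k in l, |inner ℝ (φ k - Φ (σ k) v) (Φ (σ k) w)| ≤ 2 * ε * (‖Φ 0 w‖ + 1) := by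
  set R := ‖Φ 0 w‖ + 1
  have hR : 0 < R := by positivity
  have le_at (t : ℝ) : ∀ᶠ k in l, ρ - ε ^ 2 ≤ ‖φ k - Φ (σ k) (v + t • w)‖ ^ 2 :=
    h.eventually_le _ (sub_lt_self _ (by positivity)) _
  filter_upwards [hv, le_at (ε / R), le_at (-(ε / R)),
    ((hΦ.tendsto_norm w).comp hσ).eventually_lt_const (lt_add_one _)] with k hk hk₁ hk₂ hkw
  have expand (t : ℝ) : ‖φ k - Φ (σ k) (v + t • w)‖ ^ 2 = ‖φ k - Φ (σ k) v‖ ^ 2 -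
      2 * t * inner ℝ (φ k - Φ (σ k) v) (Φ (σ k) w) + t ^ 2 * ‖Φ (σ k) w‖ ^ 2 := by
    rw [map_add, map_smul, ← sub_sub, norm_sub_sq_real, real_inner_smul_right, norm_smul, mul_pow,
      Real.norm_eq_abs, sq_abs, mul_assoc]
  have norm_sq_le : (ε / R) ^ 2 * ‖Φ (σ k) w‖ ^ 2 ≤ ε ^ 2 := by
    rw [← mul_pow, div_mul_eq_mul_div]
    gcongr
    exact div_le_of_le_mul₀ hR.le hε.le (by gcongr; exact hkw.le)
  rw [expand] at hk₁ hk₂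
  set x := inner ℝ (φ k - Φ (σ k) v) (Φ (σ k) w)
  have abs_mul_le : ε / R * |x| ≤ 2 * ε ^ 2 := by
    rw [← abs_of_pos (div_pos hε hR), ← abs_mul, abs_le]
    constructor <;> nlinarith
  calc |x| = R / ε * (ε / R * |x|) := by field_simp
    _ ≤ R / ε * (2 * ε ^ 2) := by gcongr
    _ = 2 * ε * R := by
      field_simp

theorem IsAsympRadius.exists_tendsto_inner_apply [CompleteSpace (H 0)] [l.NeBot]
    (h : IsAsympRadius Φ σ φ l ρ) (hΦ : ConvergesVia Φ) (hσ : Tendsto σ l atTop) :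
    ∃ f, ∀ w, Tendsto (fun k => inner ℝ (φ k) (Φ (σ k) w)) l (𝓝 (inner ℝ f (Φ 0 w))) := by
  let ε (m : ℕ) : ℝ := 1 / ((m : ℝ) + 1)
  have ε_pos (m : ℕ) : 0 < ε m := Nat.one_div_pos_of_nat
  have tendsto_ε : Tendsto ε atTop (𝓝 0) := tendsto_one_div_add_atTop_nhds_zero_nat
  have ε_anti {m n : ℕ} (hmn : m ≤ n) : ε n ≤ ε m := Nat.one_div_le_one_div hmn
  choose v hv using fun m => h.exists_center (ρ + ε m ^ 2) (lt_add_of_pos_right _ (by positivity))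
  have is_center {m n : ℕ} (hmn : m ≤ n) :
      ∀ᶠ k in l, ‖φ k - Φ (σ k) (v n)‖ ^ 2 < ρ + ε m ^ 2 := by
    filter_upwards [hv n] with k hk
    exact hk.trans_le (by gcongr; exact ε_anti hmn)
  have cauchy : CauchySeq fun n => Φ 0 (v n) := by
    refine cauchySeq_of_le_tendsto_0 (fun m => 3 * ε m) (fun m n N hm hn => ?_)
      (by simpa using tendsto_ε.const_mul 3)
    rw [dist_eq_norm]
    exact h.norm_sub_center_le hΦ hσ (ε_pos N) (is_center hm) (is_center hn)
  obtain ⟨f, hf⟩ := cauchySeq_tendsto_of_complete cauchy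
  refine ⟨f, fun w => tendsto_of_forall_exists_approx fun δ hδ => ?_⟩
  have tendsto_inner : Tendsto (fun m => |inner ℝ f (Φ 0 w) - inner ℝ (Φ 0 (v m)) (Φ 0 w)|) atTop
      (𝓝 0) := by
    simpa using
      ((hf.inner (tendsto_const_nhds (x := Φ 0 w))).const_sub (inner ℝ f (Φ 0 w))).abs
  have tendsto_bound : Tendsto (fun m => 2 * ε m * (‖Φ 0 w‖ + 1)) atTop (𝓝 0) := by
    simpa using (tendsto_ε.const_mul 2).mul_const (‖Φ 0 w‖ + 1)
  obtain ⟨m, hm, hm'⟩ := ((tendsto_inner.eventually_lt_const hδ).and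
    (tendsto_bound.eventually_lt_const hδ)).exists
  refine ⟨_, _, (hΦ.tendsto_inner (v m) w).comp hσ, hm, ?_⟩
  filter_upwards [h.abs_inner_le hΦ hσ (ε_pos m) (hv m) w] with k hk
  rw [Function.comp_apply, ← inner_sub_left]
  exact hk.trans_lt hm'

theorem exists_weakLim_subseq [CompleteSpace (H 0)] (hΦ : ConvergesVia Φ)
    (hσ : Tendsto σ atTop atTop) (hφ : ∃ M, ∀ k, ‖φ k‖ ≤ M) :
    ∃ (τ : ℕ → ℕ) (f : H 0), StrictMono τ ∧ WeakLim Φ (σ ∘ τ) (fun k => φ (τ k)) f := by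
  obtain ⟨l, hl, _, _, ρ, hρ⟩ := exists_isAsympRadius (Φ := Φ) (σ := σ) hφ
  obtain ⟨f, hf⟩ := hρ.exists_tendsto_inner_apply hΦ (hσ.mono_left hl)
  obtain ⟨x, hx⟩ := l.exists_seq_tendsto
  obtain ⟨τ, hτ, hτ'⟩ := strictMono_subseq_of_tendsto_atTop (hx.mono_right hl)
  exact ⟨x ∘ τ, f, hτ', hφ.imp fun _ hM k => hM _,
    fun w => (hf w).comp (hx.comp hτ.tendsto_atTop)⟩

theorem weakLim_of_forall_subseq [CompleteSpace (H 0)] (hΦ : ConvergesVia Φ)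
    (hσ : Tendsto σ atTop atTop) (hφ : ∃ M, ∀ k, ‖φ k‖ ≤ M)
    (h : ∀ (τ : ℕ → ℕ) (g : H 0), StrictMono τ →
      WeakLim Φ (σ ∘ τ) (fun k => φ (τ k)) g → g = f) :
    WeakLim Φ σ φ f := by
  refine ⟨hφ, fun v => tendsto_of_subseq_tendsto fun ns hns => ?_⟩
  obtain ⟨τ, -, hnsτ⟩ := strictMono_subseq_of_tendsto_atTop hns
  obtain ⟨τ', g, hτ', hg⟩ := exists_weakLim_subseq hΦ (hσ.comp hnsτ.tendsto_atTop)
    (φ := fun k => φ (ns (τ k))) (hφ.imp fun _ hM k => hM _)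
  obtain rfl := h _ g (hnsτ.comp hτ') hg
  exact ⟨τ ∘ τ', hg.tendsto_inner_apply v⟩

end Compactness

section GlidingHump

theorem exists_tendsto_norm_zero_inner_eq_one (hσ : IsSubseq σ)
    (hφ : ∀ k, φ k ∈ LinearMap.range (Φ (σ k))) (lt_norm : ∀ k : ℕ, (k : ℝ) < ‖φ k‖) :
    ∃ s : ∀ n, H n, s 0 = 0 ∧ (∀ n, s n ∈ LinearMap.range (Φ n)) ∧
      Tendsto (fun n => ‖s n‖) atTop (𝓝 0) ∧ ∀ k, inner ℝ (φ k) (s (σ k)) = 1 := by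
  obtain ⟨s, hs, hs_zero⟩ := exists_extension hσ.1 fun k => (‖φ k‖ ^ 2)⁻¹ • φ k
  have norm_pos (k : ℕ) : 0 < ‖φ k‖ := k.cast_nonneg.trans_lt (lt_norm k)
  have norm_eq (k : ℕ) : ‖s (σ k)‖ = ‖φ k‖⁻¹ := by
    rw [hs, norm_smul, norm_inv, norm_pow, norm_norm]
    field_simp [(norm_pos k).ne']
  refine ⟨s, hs_zero 0 fun ⟨k, hk⟩ => absurd (hσ.2 k) (by omega), fun n => ?_,
    tendsto_norm_of_tendsto_extension hσ.1 ?_ hs_zero, fun k => ?_⟩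
  · by_cases hn : n ∈ Set.range σ
    · obtain ⟨k, rfl⟩ := hn
      rw [hs]
      exact Submodule.smul_mem _ _ (hφ k)
    · rw [hs_zero n hn]
      exact zero_mem _
  · simp only [norm_eq]
    exact tendsto_inv_atTop_zero.comp
      (tendsto_atTop_mono (fun k => (lt_norm k).le) tendsto_natCast_atTop_atTop)
  · rw [hs, real_inner_smul_right, real_inner_self_eq_norm_sq]
    exact inv_mul_cancel₀ (pow_pos (norm_pos k) 2).ne'

theorem exists_norm_le_of_forall_strongLim (hΦ : ConvergesVia Φ) (hσ : IsSubseq σ)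
    (hφ : ∀ k, φ k ∈ LinearMap.range (Φ (σ k)))
    (h : ∀ s : ∀ n, H n, (∀ n, s n ∈ LinearMap.range (Φ n)) → StrongLim Φ id s (s 0) →
      Tendsto (fun k => inner ℝ (φ k) (s (σ k))) atTop (𝓝 (inner ℝ f (s 0)))) :
    ∃ M, ∀ k, ‖φ k‖ ≤ M := by
  by_contra! unbounded
  have frequently_lt (n : ℕ) : ∃ᶠ k in atTop, (n : ℝ) < ‖φ k‖ := by
    refine fun eventually_le => ?_
    obtain ⟨M, hM⟩ := (isBoundedUnder_of_eventually_le
      (eventually_le.mono fun k => not_lt.1)).bddAbove_range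
    obtain ⟨k, hk⟩ := unbounded M
    exact hk.not_ge (hM (Set.mem_range_self k))
  obtain ⟨τ, hτ, lt_norm⟩ := extraction_forall_of_frequently frequently_lt
  obtain ⟨s, s_zero, s_mem, tendsto_norm, inner_eq_one⟩ := exists_tendsto_norm_zero_inner_eq_one
    (hσ.comp hτ) (fun n => hφ (τ n)) lt_norm
  have tendsto_inner := (h s s_mem
    (s_zero ▸ hΦ.strongLim_zero tendsto_id tendsto_norm)).comp hτ.tendsto_atTop
  rw [s_zero, inner_zero_right] at tendsto_inner
  exact one_ne_zero (tendsto_nhds_unique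
    (tendsto_const_nhds.congr fun n => (inner_eq_one n).symm) tendsto_inner)

theorem weakLim_iff_forall_strongLim (hΦ : ConvergesVia Φ) (hσ : IsSubseq σ)
    (hφ : ∀ k, φ k ∈ LinearMap.range (Φ (σ k))) :
    WeakLim Φ σ φ f ↔ ∀ s : ∀ n, H n, (∀ n, 1 ≤ n → s n ∈ LinearMap.range (Φ n)) →
      StrongLim Φ id s (s 0) →
        Tendsto (fun k => inner ℝ (φ k) (s (σ k))) atTop (𝓝 (inner ℝ f (s 0))) := by
  refine ⟨fun h s _ hs => h.tendsto_inner (hs.comp hσ.1) hΦ hσ.tendsto, fun h => ⟨?_, ?_⟩⟩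
  · exact exists_norm_le_of_forall_strongLim hΦ hσ hφ fun s hs => h s fun n _ => hs n
  · exact fun v => h (fun n => Φ n v) (fun n _ => ⟨v, rfl⟩) (hΦ.strongLim tendsto_id v)

end GlidingHump

section Mosco

variable {T : ∀ n, ContractionSemigroup (H n)} {u v : ∀ k, H (σ k)} {β : ℝ} {w : H 0}

/-- Weak convergence of elements of the generator domains, along which the generators stay bounded
and which are images of test elements. -/
structure DomainWeakLim (Φ : ∀ n, V →ₗ[ℝ] H n) (T : ∀ n, ContractionSemigroup (H n)) (σ : ℕ → ℕ)
    (u : ∀ k, H (σ k)) (w : H 0) : Prop extends WeakLim Φ σ u w where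
  mem_domain : ∀ k, u k ∈ (T (σ k)).domain
  mem_range : ∀ k, u k ∈ LinearMap.range (Φ (σ k))
  exists_norm_generator_le : ∃ M, ∀ k, ‖(T (σ k)).generator (u k)‖ ≤ M

/-- A recovery sequence for `f`: strong convergence, with bounded generators, along which the form
does not jump up. -/
structure RecoverySeq (Φ : ∀ n, V →ₗ[ℝ] H n) (T : ∀ n, ContractionSemigroup (H n)) (σ : ℕ → ℕ)
    (ψ : ∀ k, H (σ k)) (f : H 0) : Prop extends DomainWeakLim Φ T σ ψ f where
  tendsto_norm : Tendsto (fun k => ‖ψ k‖) atTop (𝓝 ‖f‖)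
  limsup_form_le : limsup (fun k => (((T (σ k)).form (ψ k) (ψ k) : ℝ) : EReal)) atTop ≤
    (((T 0).form f f : ℝ) : EReal)

/-- Mosco-type convergence of the forms of the semigroups `T n` to the form of `T 0`, on Hilbert
spaces `H n` converging to `H 0`, with the images of the test elements stable under the
resolvents. -/
structure MoscoConverge (Φ : ∀ n, V →ₗ[ℝ] H n) (T : ∀ n, ContractionSemigroup (H n)) : Prop
    extends ConvergesVia Φ where
  resolvent_mem_range : ∀ β : ℝ, 0 < β → ∀ n, 1 ≤ n → ∀ g ∈ LinearMap.range (Φ n),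
    (T n).resolvent β g ∈ LinearMap.range (Φ n)
  lowerBound : ∀ σ : ℕ → ℕ, IsSubseq σ → ∀ (u : ∀ k, H (σ k)) (w : H 0),
    DomainWeakLim Φ T σ u w → w ∈ (T 0).domain ∧ (((T 0).form w w : ℝ) : EReal) ≤
      liminf (fun k => (((T (σ k)).form (u k) (u k) : ℝ) : EReal)) atTop
  exists_recoverySeq_succ : ∀ f ∈ (T 0).domain, ∃ ψ : ∀ k, H (k + 1),
    RecoverySeq Φ T (fun k => k + 1) ψ f
  formDuality : ∀ β : ℝ, 0 < β → ∀ σ : ℕ → ℕ, IsSubseq σ → ∀ (u : ∀ k, H (σ k)) (v : H 0),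
    (∃ w, DomainWeakLim Φ T σ u w) →
    (∀ k, (T (σ k)).generator (u k) ∈ LinearMap.range (Φ (σ k))) → v ∈ (T 0).domain →
    (∀ (ψ : ∀ k, H (σ k)) (f : H 0), StrongLim Φ σ ψ f →
      Tendsto (fun k => (T (σ k)).formShift β (u k) (ψ k)) atTop
        (𝓝 ((T 0).formShift β v f))) →
    ∀ (ψ : ∀ k, H (σ k)) (f : H 0), f ∈ (T 0).domain → RecoverySeq Φ T σ ψ f →
      Tendsto (fun k => (T (σ k)).formShift β (ψ k) (u k)) atTop (𝓝 ((T 0).formShift β f v))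

theorem DomainWeakLim.sub (hu : DomainWeakLim Φ T σ u f) (hv : DomainWeakLim Φ T σ v g) :
    DomainWeakLim Φ T σ (fun k => u k - v k) (f - g) where
  toWeakLim := hu.toWeakLim.sub hv.toWeakLim
  mem_domain k := ContractionSemigroup.sub_mem_domain (hu.mem_domain k) (hv.mem_domain k)
  mem_range k := sub_mem (hu.mem_range k) (hv.mem_range k)
  exists_norm_generator_le := by
    obtain ⟨M, hM⟩ := hu.exists_norm_generator_le
    obtain ⟨N, hN⟩ := hv.exists_norm_generator_le
    refine ⟨M + N, fun k => ?_⟩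
    rw [ContractionSemigroup.generator_sub (hu.mem_domain k) (hv.mem_domain k)]
    exact (norm_sub_le _ _).trans (add_le_add (hM k) (hN k))

theorem RecoverySeq.strongLim (hψ : RecoverySeq Φ T σ ψ f) : StrongLim Φ σ ψ f :=
  ⟨hψ.tendsto_inner_apply, hψ.tendsto_norm⟩

theorem limsup_comp_le {a : ℕ → EReal} (hτ : StrictMono τ) :
    limsup (fun k => a (τ k)) atTop ≤ limsup a atTop :=
  limsup_le_limsup_of_le (f := map τ atTop) (g := atTop) hτ.tendsto_atTop

theorem RecoverySeq.comp (hψ : RecoverySeq Φ T σ ψ f) (hτ : StrictMono τ) :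
    RecoverySeq Φ T (σ ∘ τ) (fun k => ψ (τ k)) f where
  toWeakLim := hψ.toWeakLim.comp hτ
  mem_domain k := hψ.mem_domain (τ k)
  mem_range k := hψ.mem_range (τ k)
  exists_norm_generator_le := hψ.exists_norm_generator_le.imp fun _ hM k => hM (τ k)
  tendsto_norm := hψ.tendsto_norm.comp hτ.tendsto_atTop
  limsup_form_le := (limsup_comp_le (a := fun k => (((T (σ k)).form (ψ k) (ψ k) : ℝ) : EReal))
    hτ).trans hψ.limsup_form_le

namespace MoscoConverge

theorem exists_recoverySeq (h : MoscoConverge Φ T) (hσ : IsSubseq σ) (hf : f ∈ (T 0).domain) :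
    ∃ ψ : ∀ k, H (σ k), RecoverySeq Φ T σ ψ f := by
  obtain ⟨τ, hτ, rfl⟩ := hσ.exists_eq_succ
  obtain ⟨ψ, hψ⟩ := h.exists_recoverySeq_succ f hf
  exact ⟨_, hψ.comp hτ⟩

theorem tendsto_formShift (h : MoscoConverge Φ T) (hσ : IsSubseq σ)
    (hψ : RecoverySeq Φ T σ ψ f) :
    Tendsto (fun k => (T (σ k)).formShift β (ψ k) (ψ k)) atTop (𝓝 ((T 0).formShift β f f)) := by
  have tendsto_form : Tendsto (fun k => (T (σ k)).form (ψ k) (ψ k)) atTop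
      (𝓝 ((T 0).form f f)) :=
    EReal.tendsto_coe.1 <| tendsto_of_le_liminf_of_limsup_le
      (h.lowerBound σ hσ ψ f hψ.toDomainWeakLim).2 hψ.limsup_form_le
  simp only [ContractionSemigroup.formShift_self]
  exact ((hψ.tendsto_norm.pow 2).const_mul β).add tendsto_form

/-- Lower semicontinuity of `S_β` reduces to that of `S` after completing the square around a test
element close to the limit. -/
theorem formShift_le_of_tendsto (h : MoscoConverge Φ T) (hβ : 0 ≤ β) (hσ : IsSubseq σ)
    (hu : DomainWeakLim Φ T σ u w) {c : ℝ}
    (hc : Tendsto (fun k => (T (σ k)).formShift β (u k) (u k)) atTop (𝓝 c)) :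
    (T 0).formShift β w w ≤ c := by
  have le_test (v : V) : (T 0).formShift β w w ≤ c + β * ‖w - Φ 0 v‖ ^ 2 := by
    have tendsto_bound : Tendsto (fun k => (T (σ k)).formShift β (u k) (u k) -
        β * (2 * inner ℝ (u k) (Φ (σ k) v) - ‖Φ (σ k) v‖ ^ 2)) atTop
        (𝓝 (c - β * (2 * inner ℝ w (Φ 0 v) - ‖Φ 0 v‖ ^ 2))) :=
      hc.sub ((((hu.tendsto_inner_apply v).const_mul 2).sub
        (((h.tendsto_norm v).comp hσ.tendsto).pow 2)).const_mul β)
    have form_le (k : ℕ) : (T (σ k)).form (u k) (u k) ≤ (T (σ k)).formShift β (u k) (u k) -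
        β * (2 * inner ℝ (u k) (Φ (σ k) v) - ‖Φ (σ k) v‖ ^ 2) := by
      have := mul_nonneg hβ (sq_nonneg ‖u k - Φ (σ k) v‖)
      rw [norm_sub_sq_real] at this
      rw [ContractionSemigroup.formShift_self]
      linarith
    have form_le_limit : (((T 0).form w w : ℝ) : EReal) ≤ _ :=
      (h.lowerBound σ hσ u w hu).2.trans <|
        (liminf_le_liminf (Eventually.of_forall fun k => EReal.coe_le_coe_iff.2 (form_le k))).trans
          (EReal.tendsto_coe.2 tendsto_bound).liminf_eq.le
    rw [ContractionSemigroup.formShift_self, norm_sub_sq_real]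
    linarith [EReal.coe_le_coe_iff.1 form_le_limit]
  have isClosed : IsClosed {x | (T 0).formShift β w w ≤ c + β * ‖w - x‖ ^ 2} :=
    isClosed_le continuous_const (by fun_prop)
  simpa using h.denseRange.induction_on (p := fun x => (T 0).formShift β w w ≤ c + β * ‖w - x‖ ^ 2)
    w isClosed le_test

variable [∀ n, CompleteSpace (H n)]

theorem domainWeakLim_resolvent (h : MoscoConverge Φ T) (hβ : 0 < β) (hσ : IsSubseq σ)
    (hφ_mem : ∀ k, φ k ∈ LinearMap.range (Φ (σ k))) (hφ : ∃ M, ∀ k, ‖φ k‖ ≤ M)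
    (hw : WeakLim Φ σ (fun k => (T (σ k)).resolvent β (φ k)) w) :
    DomainWeakLim Φ T σ (fun k => (T (σ k)).resolvent β (φ k)) w where
  toWeakLim := hw
  mem_domain k := (T (σ k)).resolvent_mem_domain hβ (φ k)
  mem_range k := h.resolvent_mem_range β hβ (σ k) (hσ.2 k) (φ k) (hφ_mem k)
  exists_norm_generator_le := by
    obtain ⟨M, hM⟩ := hφ
    exact ⟨2 * M, fun k => ((T (σ k)).norm_generator_resolvent_le hβ (φ k)).trans
      (mul_le_mul_of_nonneg_left (hM k) zero_le_two)⟩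

theorem tendsto_formShift_resolvent (h : MoscoConverge Φ T) (hβ : 0 < β) (hσ : IsSubseq σ)
    (hφ_mem : ∀ k, φ k ∈ LinearMap.range (Φ (σ k))) (hφ : WeakLim Φ σ φ f)
    (hw : WeakLim Φ σ (fun k => (T (σ k)).resolvent β (φ k)) w) (hψ : RecoverySeq Φ T σ ψ g) :
    Tendsto (fun k => (T (σ k)).formShift β (ψ k) ((T (σ k)).resolvent β (φ k))) atTop
      (𝓝 ((T 0).formShift β g ((T 0).resolvent β f))) := by
  have hu := h.domainWeakLim_resolvent hβ hσ hφ_mem hφ.exists_norm_le hw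
  refine h.formDuality β hβ σ hσ _ _ ⟨w, hu⟩ (fun k => ?_) ((T 0).resolvent_mem_domain hβ f)
    (fun χ c hχ => ?_) ψ g (h.lowerBound σ hσ ψ g hψ.toDomainWeakLim).1 hψ
  · rw [(T (σ k)).generator_resolvent hβ]
    exact sub_mem (Submodule.smul_mem _ β (hu.mem_range k)) (hφ_mem k)
  · simp only [(T _).formShift_resolvent hβ]
    exact hφ.tendsto_inner hχ h.toConvergesVia hσ.tendsto

theorem tendsto_formShift_resolvent_sub (h : MoscoConverge Φ T) (hβ : 0 < β) (hσ : IsSubseq σ)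
    (hφ_mem : ∀ k, φ k ∈ LinearMap.range (Φ (σ k))) (hφ : StrongLim Φ σ φ f)
    (hw : WeakLim Φ σ (fun k => (T (σ k)).resolvent β (φ k)) w) (hψ : RecoverySeq Φ T σ ψ g) :
    Tendsto (fun k => (T (σ k)).formShift β ((T (σ k)).resolvent β (φ k) - ψ k)
        ((T (σ k)).resolvent β (φ k) - ψ k)) atTop
      (𝓝 (inner ℝ f (w - g) -
        ((T 0).formShift β g ((T 0).resolvent β f) - (T 0).formShift β g g))) := by
  have tendsto_inner := (hw.sub hψ.toWeakLim).tendsto_inner hφ h.toConvergesVia hσ.tendsto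
  rw [real_inner_comm] at tendsto_inner
  refine (tendsto_inner.sub
    ((h.tendsto_formShift_resolvent hβ hσ hφ_mem hφ.weakLim hw hψ).sub
      (h.tendsto_formShift hσ hψ))).congr fun k => ?_
  rw [ContractionSemigroup.formShift_sub_left ((T (σ k)).resolvent_mem_domain hβ _)
    (hψ.mem_domain k), (T (σ k)).formShift_resolvent hβ,
    ContractionSemigroup.formShift_sub_right (u := ψ k), real_inner_comm]

theorem eq_resolvent_of_weakLim (h : MoscoConverge Φ T) (hβ : 0 < β) (hσ : IsSubseq σ)
    (hφ_mem : ∀ k, φ k ∈ LinearMap.range (Φ (σ k))) (hφ : StrongLim Φ σ φ f)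
    (hw : WeakLim Φ σ (fun k => (T (σ k)).resolvent β (φ k)) w) : w = (T 0).resolvent β f := by
  have hu := h.domainWeakLim_resolvent hβ hσ hφ_mem hφ.weakLim.exists_norm_le hw
  refine (T 0).eq_resolvent_of_forall_formShift_le hβ (h.lowerBound σ hσ _ w hu).1 fun g hg => ?_
  obtain ⟨ψ, hψ⟩ := h.exists_recoverySeq hσ hg
  exact h.formShift_le_of_tendsto hβ.le hσ (hu.sub hψ.toDomainWeakLim)
    (h.tendsto_formShift_resolvent_sub hβ hσ hφ_mem hφ hw hψ)

theorem exists_norm_resolvent_le (T : ∀ n, ContractionSemigroup (H n)) (hβ : 0 < β)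
    (hφ : ∃ M, ∀ k, ‖φ k‖ ≤ M) : ∃ M, ∀ k, ‖(T (σ k)).resolvent β (φ k)‖ ≤ M :=
  hφ.imp' (β⁻¹ * ·) fun _ hM k => ((T (σ k)).norm_resolvent_le hβ (φ k)).trans
    (mul_le_mul_of_nonneg_left (hM k) (inv_nonneg.2 hβ.le))

theorem strongLim_resolvent (h : MoscoConverge Φ T) (hβ : 0 < β) (hσ : IsSubseq σ)
    (hφ_mem : ∀ k, φ k ∈ LinearMap.range (Φ (σ k))) (hφ : StrongLim Φ σ φ f) :
    StrongLim Φ σ (fun k => (T (σ k)).resolvent β (φ k)) ((T 0).resolvent β f) := by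
  have hw : WeakLim Φ σ (fun k => (T (σ k)).resolvent β (φ k)) ((T 0).resolvent β f) :=
    weakLim_of_forall_subseq h.toConvergesVia hσ.tendsto
      (exists_norm_resolvent_le T hβ hφ.weakLim.exists_norm_le) fun τ w hτ hw =>
        h.eq_resolvent_of_weakLim hβ (hσ.comp hτ) (fun k => hφ_mem (τ k)) (hφ.comp hτ) hw
  obtain ⟨ψ, hψ⟩ := h.exists_recoverySeq hσ ((T 0).resolvent_mem_domain hβ f)
  have tendsto_formShift := h.tendsto_formShift_resolvent_sub hβ hσ hφ_mem hφ hw hψ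
  simp only [sub_self, inner_zero_right] at tendsto_formShift
  have tendsto_norm_sub_sq :
      Tendsto (fun k => ‖(T (σ k)).resolvent β (φ k) - ψ k‖ ^ 2) atTop (𝓝 0) := by
    refine squeeze_zero (fun k => sq_nonneg _) (fun k => ?_)
      (by simpa using tendsto_formShift.const_mul β⁻¹)
    rw [← div_eq_inv_mul, le_div_iff₀ hβ, mul_comm]
    exact ContractionSemigroup.mul_norm_sq_le_formShift_self
      (ContractionSemigroup.sub_mem_domain ((T (σ k)).resolvent_mem_domain hβ _) (hψ.mem_domain k))
  refine ⟨hw.tendsto_inner_apply, tendsto_of_tendsto_of_dist hψ.tendsto_norm ?_⟩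
  refine squeeze_zero (fun k => dist_nonneg) (fun k => ?_) (by simpa using tendsto_norm_sub_sq.sqrt)
  rw [dist_comm]
  exact abs_norm_sub_norm_le _ _

theorem recoverySeq_resolvent (h : MoscoConverge Φ T) (hβ : 0 < β) (hσ : IsSubseq σ)
    (hφ_mem : ∀ k, φ k ∈ LinearMap.range (Φ (σ k))) (hφ : StrongLim Φ σ φ f) :
    RecoverySeq Φ T σ (fun k => (T (σ k)).resolvent β (φ k)) ((T 0).resolvent β f) where
  toDomainWeakLim := h.domainWeakLim_resolvent hβ hσ hφ_mem hφ.weakLim.exists_norm_le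
    (h.strongLim_resolvent hβ hσ hφ_mem hφ).weakLim
  tendsto_norm := (h.strongLim_resolvent hβ hσ hφ_mem hφ).tendsto_norm
  limsup_form_le := by
    have strong := h.strongLim_resolvent hβ hσ hφ_mem hφ
    simp only [(T _).form_resolvent_self hβ]
    exact (EReal.tendsto_coe.2
      ((hφ.weakLim.tendsto_inner strong h.toConvergesVia hσ.tendsto).sub
        ((strong.tendsto_norm.pow 2).const_mul β))).limsup_eq.le

theorem weakLim_dual_resolvent (h : MoscoConverge Φ T) (hβ : 0 < β) (hσ : IsSubseq σ)
    (hφ : WeakLim Φ σ φ f) :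
    WeakLim Φ σ (fun k => (T (σ k)).dual.resolvent β (φ k)) ((T 0).dual.resolvent β f) := by
  refine ⟨exists_norm_resolvent_le (fun n => (T n).dual) hβ hφ.exists_norm_le, fun v => ?_⟩
  simp only [(T _).inner_dual_resolvent hβ]
  exact hφ.tendsto_inner (h.strongLim_resolvent hβ hσ (fun k => ⟨v, rfl⟩)
    (h.toConvergesVia.strongLim hσ.tendsto v)) h.toConvergesVia hσ.tendsto

theorem weakLim_resolvent (h : MoscoConverge Φ T) (hβ : 0 < β) (hσ : IsSubseq σ)
    (hφ_mem : ∀ k, φ k ∈ LinearMap.range (Φ (σ k))) (hφ : WeakLim Φ σ φ f) :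
    WeakLim Φ σ (fun k => (T (σ k)).resolvent β (φ k)) ((T 0).resolvent β f) := by
  refine weakLim_of_forall_subseq h.toConvergesVia hσ.tendsto
    (exists_norm_resolvent_le T hβ hφ.exists_norm_le) fun τ w hτ hw => ?_
  have inner_eq (v : V) : inner ℝ w (Φ 0 v) = inner ℝ ((T 0).resolvent β f) (Φ 0 v) := by
    have tendsto_formShift := h.tendsto_formShift_resolvent hβ (hσ.comp hτ)
      (fun k => hφ_mem (τ k)) (hφ.comp hτ) hw (h.recoverySeq_resolvent hβ (hσ.comp hτ)
        (fun k => ⟨v, rfl⟩) (h.toConvergesVia.strongLim (hσ.comp hτ).tendsto v))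
    simp only [(T _).formShift_resolvent hβ, real_inner_comm _ (Φ _ v)] at tendsto_formShift
    exact tendsto_nhds_unique (hw.tendsto_inner_apply v) tendsto_formShift
  exact h.denseRange.eq_of_inner_left ℝ inner_eq

theorem strongLim_dual_resolvent (h : MoscoConverge Φ T) (hβ : 0 < β) (hσ : IsSubseq σ)
    (hdual_mem : ∀ k, (T (σ k)).dual.resolvent β (φ k) ∈ LinearMap.range (Φ (σ k)))
    (hφ : StrongLim Φ σ φ f) :
    StrongLim Φ σ (fun k => (T (σ k)).dual.resolvent β (φ k)) ((T 0).dual.resolvent β f) := by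
  have weak := h.weakLim_dual_resolvent hβ hσ hφ.weakLim
  have norm_sq_eq (n : ℕ) (x : H n) : inner ℝ ((T n).resolvent β ((T n).dual.resolvent β x)) x =
      ‖(T n).dual.resolvent β x‖ ^ 2 := by
    rw [real_inner_comm, ← (T n).inner_dual_resolvent hβ, real_inner_self_eq_norm_sq]
  have tendsto_norm_sq := (h.weakLim_resolvent hβ hσ hdual_mem weak).tendsto_inner hφ
    h.toConvergesVia hσ.tendsto
  simp only [norm_sq_eq] at tendsto_norm_sq
  exact ⟨weak.tendsto_inner_apply, by simpa using tendsto_norm_sq.sqrt⟩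

end MoscoConverge

end Mosco

end VaryingHilbert

namespace MoscoSeq

open VaryingHilbert

variable {E : Type*} [MeasurableSpace E] {α : ℕ → ℝ≥0} {ν : ℕ → Measure E}

section Fibres

theorem absolutelyContinuous_mixture (hα : ∀ n, 0 < α n) (n : ℕ) : ν n ≪ mixture α ν :=
  (Measure.absolutelyContinuous_smul (ENNReal.coe_ne_zero.2 (hα n).ne')).trans
    (Measure.le_sum (fun n => α n • ν n) n).absolutelyContinuous

theorem exists_forall_ae_eq (hα : ∀ n, 0 < α n) {carrier : ℕ → Set E}
    (hcarrier_meas : ∀ n, MeasurableSet (carrier n))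
    (hcarrier_disj : Pairwise fun m n => Disjoint (carrier m) (carrier n))
    (hcarrier : ∀ n, ν n (carrier n)ᶜ = 0) (s : ∀ n, Lp ℝ 2 (ν n)) :
    ∃ φ : E →ₘ[mixture α ν] ℝ, ∀ n, s n =ᵐ[ν n] φ := by
  obtain ⟨f, hf, f_eq⟩ := exists_measurable_piecewise carrier hcarrier_meas (fun n => s n)
    (fun n => (Lp.stronglyMeasurable (s n)).measurable) fun m n hmn x hx =>
      ((hcarrier_disj hmn).notMem_of_mem_left hx.1 hx.2).elim
  refine ⟨AEEqFun.mk f hf.aestronglyMeasurable, fun n => ?_⟩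
  filter_upwards [(absolutelyContinuous_mixture hα n).ae_eq
    (AEEqFun.coeFn_mk f (hf.aestronglyMeasurable (μ := mixture α ν))),
    (mem_ae_iff.2 (hcarrier n) : carrier n ∈ ae (ν n))] with x hx hxn
  rw [hx, f_eq n hxn]

theorem pairing_eq_inner {n : ℕ} {φ ψ : E → ℝ} {u v : Lp ℝ 2 (ν n)} (hu : u =ᵐ[ν n] φ)
    (hv : v =ᵐ[ν n] ψ) : pairing ν n φ ψ = inner ℝ u v := by
  rw [L2.inner_def]
  refine integral_congr_ae ?_
  filter_upwards [hu, hv] with x hux hvx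
  rw [hux, hvx, real_inner_comm, RCLike.inner_apply, conj_trivial, mul_comm]

variable {F : Submodule ℝ (E →ₘ[mixture α ν] ℝ)}

/-- The map sending an element of `F` to its class in `L²(E, ν_n)`; through these maps, `F` serves
as the space of test elements. -/
noncomputable def fibreMap (hα : ∀ n, 0 < α n)
    (hF : (F : Set (E →ₘ[mixture α ν] ℝ)) ⊆ classD α ν) (n : ℕ) : F →ₗ[ℝ] Lp ℝ 2 (ν n) where
  toFun φ := ((hF φ.2).1 n).toLp φ
  map_add' φ ψ := MemLp.toLp_congr _ (((hF φ.2).1 n).add ((hF ψ.2).1 n))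
    ((absolutelyContinuous_mixture hα n).ae_eq (AEEqFun.coeFn_add φ.1 ψ.1))
  map_smul' c φ := MemLp.toLp_congr _ (((hF φ.2).1 n).const_smul c)
    ((absolutelyContinuous_mixture hα n).ae_eq (AEEqFun.coeFn_smul c φ.1))

variable {hα : ∀ n, 0 < α n} {hF : (F : Set (E →ₘ[mixture α ν] ℝ)) ⊆ classD α ν}

theorem coeFn_fibreMap (n : ℕ) (φ : F) : fibreMap hα hF n φ =ᵐ[ν n] φ.1 :=
  MemLp.coeFn_toLp ((hF φ.2).1 n)

theorem mem_range_fibreMap_iff {n : ℕ} {u : Lp ℝ 2 (ν n)} :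
    u ∈ LinearMap.range (fibreMap hα hF n) ↔
      u ∈ trace ν (F : Set (E →ₘ[mixture α ν] ℝ)) n := by
  constructor
  · rintro ⟨φ, rfl⟩
    exact ⟨φ, φ.2, coeFn_fibreMap n φ⟩
  · rintro ⟨φ, hφ, hu⟩
    exact ⟨⟨φ, hφ⟩, Lp.ext ((coeFn_fibreMap n ⟨φ, hφ⟩).trans hu.symm)⟩

theorem mem_classD_iff {φ : E →ₘ[mixture α ν] ℝ} {s : ∀ n, Lp ℝ 2 (ν n)}
    (hs : ∀ n, s n =ᵐ[ν n] φ) :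
    φ ∈ classD α ν ↔ Tendsto (fun n => ‖s n‖) atTop (𝓝 ‖s 0‖) := by
  have pairing_eq (n : ℕ) : pairing ν n φ φ = ‖s n‖ ^ 2 := by
    rw [pairing_eq_inner (hs n) (hs n), real_inner_self_eq_norm_sq]
  simp only [classD, Set.mem_ofPred_eq, pairing_eq]
  exact ⟨fun h => by simpa using h.2.sqrt,
    fun h => ⟨fun n => (memLp_congr_ae (hs n)).1 (Lp.memLp (s n)), h.pow 2⟩⟩

theorem convergesVia_fibreMap
    (hF_dense : Dense (trace ν (F : Set (E →ₘ[mixture α ν] ℝ)) 0)) :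
    ConvergesVia (fibreMap hα hF) where
  denseRange := hF_dense.mono fun _ hu => mem_range_fibreMap_iff.2 hu
  tendsto_norm φ := (mem_classD_iff fun n => coeFn_fibreMap n φ).1 (hF φ.2)

theorem mem_classC_iff {φ : E →ₘ[mixture α ν] ℝ} {s : ∀ n, Lp ℝ 2 (ν n)}
    (hs : ∀ n, s n =ᵐ[ν n] φ) :
    φ ∈ classC ν F ↔ (∀ n, 1 ≤ n → s n ∈ LinearMap.range (fibreMap hα hF n)) ∧
      StrongLim (fibreMap hα hF) id s (s 0) := by
  have mem_range_iff (n : ℕ) :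
      s n ∈ LinearMap.range (fibreMap hα hF n) ↔ ∃ χ ∈ F, φ =ᵐ[ν n] χ := by
    rw [mem_range_fibreMap_iff]
    exact exists_congr fun χ => and_congr_right fun _ =>
      ⟨(hs n).symm.trans, (hs n).trans⟩
  have pairing_eq (n : ℕ) (ψ : F) : pairing ν n φ ψ.1 = inner ℝ (s n) (fibreMap hα hF n ψ) :=
    pairing_eq_inner (hs n) (coeFn_fibreMap n ψ)
  simp only [mem_range_iff]
  constructor
  · rintro ⟨hφ_classD, hφ_repr, hφ_pairing⟩
    refine ⟨hφ_repr, fun ψ => ?_, (mem_classD_iff hs).1 hφ_classD⟩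
    simpa only [pairing_eq _ ψ, id_eq] using hφ_pairing ψ ψ.2
  · rintro ⟨hφ_repr, tendsto_inner, tendsto_norm⟩
    refine ⟨(mem_classD_iff hs).2 tendsto_norm, hφ_repr, fun ψ hψ => ?_⟩
    simpa only [pairing_eq _ ⟨ψ, hψ⟩, id_eq] using tendsto_inner ⟨ψ, hψ⟩

theorem subset_classC (hΦ : ConvergesVia (fibreMap hα hF)) :
    (F : Set (E →ₘ[mixture α ν] ℝ)) ⊆ classC ν F := fun φ hφ =>
  (mem_classC_iff fun n => coeFn_fibreMap n ⟨φ, hφ⟩).2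
    ⟨fun _ _ => ⟨⟨φ, hφ⟩, rfl⟩, hΦ.strongLim tendsto_id ⟨φ, hφ⟩⟩

theorem mem_trace_classC_iff (hΦ : ConvergesVia (fibreMap hα hF)) {n : ℕ} (hn : 1 ≤ n)
    {u : Lp ℝ 2 (ν n)} :
    u ∈ trace ν (classC ν F) n ↔ u ∈ LinearMap.range (fibreMap hα hF n) := by
  rw [mem_range_fibreMap_iff]
  constructor
  · rintro ⟨φ, hφ, hu⟩
    obtain ⟨χ, hχ, hφχ⟩ := hφ.2.1 n hn
    exact ⟨χ, hχ, hu.trans hφχ⟩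
  · rintro ⟨χ, hχ, hu⟩
    exact ⟨χ, subset_classC hΦ hχ, hu⟩

end Fibres

section Convergence

variable {F : Submodule ℝ (E →ₘ[mixture α ν] ℝ)} {hα : ∀ n, 0 < α n}
  {hF : (F : Set (E →ₘ[mixture α ν] ℝ)) ⊆ classD α ν} {σ : ℕ → ℕ}
  {φ : ∀ k, Lp ℝ 2 (ν (σ k))} {f : Lp ℝ 2 (ν 0)}
  {T : ∀ n, ContractionSemigroup (Lp ℝ 2 (ν n))}

theorem wConv_iff (hΦ : ConvergesVia (fibreMap hα hF))
    (hglue : ∀ s : ∀ n, Lp ℝ 2 (ν n), ∃ φ : E →ₘ[mixture α ν] ℝ, ∀ n, s n =ᵐ[ν n] φ)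
    (hσ : IsSubseq σ) :
    WConv F σ φ f ↔ (∀ k, φ k ∈ LinearMap.range (fibreMap hα hF (σ k))) ∧
      WeakLim (fibreMap hα hF) σ φ f := by
  rw [WConv, forall_congr' fun k => mem_trace_classC_iff hΦ (hσ.2 k)]
  refine and_congr_right fun hφ => (Iff.trans ⟨?_, ?_⟩ (weakLim_iff_forall_strongLim hΦ hσ hφ).symm)
  · intro h s hs_mem hs
    obtain ⟨ψ, hψ⟩ := hglue s
    simpa only [pairing_eq_inner EventuallyEq.rfl (hψ _)] using
      h ψ ((mem_classC_iff hψ).2 ⟨hs_mem, hs⟩)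
  · intro h ψ hψ
    have ae_eq (n : ℕ) : (hψ.1.1 n).toLp ψ =ᵐ[ν n] ψ := MemLp.coeFn_toLp _
    obtain ⟨mem_range, strongLim⟩ := (mem_classC_iff ae_eq).1 hψ
    simpa only [pairing_eq_inner EventuallyEq.rfl (ae_eq _)] using h _ mem_range strongLim

theorem sConv_iff (hΦ : ConvergesVia (fibreMap hα hF))
    (hglue : ∀ s : ∀ n, Lp ℝ 2 (ν n), ∃ φ : E →ₘ[mixture α ν] ℝ, ∀ n, s n =ᵐ[ν n] φ)
    (hσ : IsSubseq σ) :
    SConv F σ φ f ↔ (∀ k, φ k ∈ LinearMap.range (fibreMap hα hF (σ k))) ∧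
      StrongLim (fibreMap hα hF) σ φ f := by
  simp only [SConv, wConv_iff hΦ hglue hσ, real_inner_self_eq_norm_sq]
  constructor
  · rintro ⟨⟨hφ, weak⟩, tendsto_norm_sq⟩
    exact ⟨hφ, weak.tendsto_inner_apply, by simpa using tendsto_norm_sq.sqrt⟩
  · rintro ⟨hφ, strong⟩
    exact ⟨⟨hφ, strong.weakLim⟩, strong.tendsto_norm.pow 2⟩

theorem bddGenerators_iff :
    BddGenerators T σ φ ↔ ∃ M, ∀ k, ‖(T (σ k)).generator (φ k)‖ ≤ M := by
  simp only [BddGenerators, bddAbove_def, Set.forall_mem_range, real_inner_self_eq_norm_sq]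
  constructor
  · rintro ⟨M, hM⟩
    exact ⟨√M, fun k => Real.le_sqrt_of_sq_le (hM k)⟩
  · rintro ⟨M, hM⟩
    exact ⟨M ^ 2, fun k => pow_le_pow_left₀ (norm_nonneg _) (hM k) 2⟩

theorem domainWeakLim_iff (hΦ : ConvergesVia (fibreMap hα hF))
    (hglue : ∀ s : ∀ n, Lp ℝ 2 (ν n), ∃ φ : E →ₘ[mixture α ν] ℝ, ∀ n, s n =ᵐ[ν n] φ)
    (hσ : IsSubseq σ) :
    DomainWeakLim (fibreMap hα hF) T σ φ f ↔
      (∀ k, φ k ∈ (T (σ k)).domain) ∧ WConv F σ φ f ∧ BddGenerators T σ φ := by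
  rw [wConv_iff hΦ hglue hσ, bddGenerators_iff]
  exact ⟨fun h => ⟨h.mem_domain, ⟨h.mem_range, h.toWeakLim⟩, h.exists_norm_generator_le⟩,
    fun ⟨hφ, ⟨hφ_mem, weak⟩, bdd⟩ => ⟨weak, hφ, hφ_mem, bdd⟩⟩

theorem recoverySeq_iff (hΦ : ConvergesVia (fibreMap hα hF))
    (hglue : ∀ s : ∀ n, Lp ℝ 2 (ν n), ∃ φ : E →ₘ[mixture α ν] ℝ, ∀ n, s n =ᵐ[ν n] φ)
    (hσ : IsSubseq σ) :
    RecoverySeq (fibreMap hα hF) T σ φ f ↔ IsRecovery F T σ φ f := by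
  rw [IsRecovery, sConv_iff hΦ hglue hσ, bddGenerators_iff]
  exact ⟨fun h => ⟨h.mem_domain, ⟨h.mem_range, h.strongLim⟩, h.exists_norm_generator_le,
      h.limsup_form_le⟩,
    fun ⟨hφ, ⟨hφ_mem, strong⟩, bdd, limsup_le⟩ =>
      ⟨⟨strong.weakLim, hφ, hφ_mem, bdd⟩, strong.tendsto_norm, limsup_le⟩⟩

theorem ResolventStable.resolvent_mem_range (hstable : ResolventStable F T)
    (hΦ : ConvergesVia (fibreMap hα hF)) {β : ℝ} (hβ : 0 < β) {n : ℕ} (hn : 1 ≤ n)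
    {g : Lp ℝ 2 (ν n)} (hg : g ∈ LinearMap.range (fibreMap hα hF n)) :
    (T n).resolvent β g ∈ LinearMap.range (fibreMap hα hF n) := by
  rw [← mem_trace_classC_iff hΦ hn] at hg ⊢
  exact (hstable n β hβ g hg).1

theorem ResolventStable.dual_resolvent_mem_range (hstable : ResolventStable F T)
    (hΦ : ConvergesVia (fibreMap hα hF)) {β : ℝ} (hβ : 0 < β) {n : ℕ} (hn : 1 ≤ n)
    {g : Lp ℝ 2 (ν n)} (hg : g ∈ LinearMap.range (fibreMap hα hF n)) :
    (T n).dual.resolvent β g ∈ LinearMap.range (fibreMap hα hF n) := by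
  rw [← mem_trace_classC_iff hΦ hn] at hg ⊢
  exact (hstable n β hβ g hg).2

theorem FormsConverge.moscoConverge (hconv : FormsConverge F T) (hstable : ResolventStable F T)
    (hΦ : ConvergesVia (fibreMap hα hF))
    (hglue : ∀ s : ∀ n, Lp ℝ 2 (ν n), ∃ φ : E →ₘ[mixture α ν] ℝ, ∀ n, s n =ᵐ[ν n] φ) :
    MoscoConverge (fibreMap hα hF) T where
  toConvergesVia := hΦ
  resolvent_mem_range _ hβ _ hn _ hg := hstable.resolvent_mem_range hΦ hβ hn hg
  lowerBound σ hσ u w hu := by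
    obtain ⟨hu_mem, hu_conv, hu_bdd⟩ := (domainWeakLim_iff hΦ hglue hσ).1 hu
    exact hconv.lowerBound σ hσ u w hu_mem hu_conv hu_bdd
  exists_recoverySeq_succ f hf :=
    (hconv.hasRecovery f hf).imp fun _ hψ => (recoverySeq_iff hΦ hglue isSubseq_succ).2 hψ
  formDuality β hβ σ hσ u v := by
    rintro ⟨w, hu⟩ hu_gen hv tendsto_left ψ f hf hψ
    obtain ⟨hu_mem, hu_conv, hu_bdd⟩ := (domainWeakLim_iff hΦ hglue hσ).1 hu
    exact hconv.formDuality β hβ σ hσ u v hu_mem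
      (fun k => (mem_trace_classC_iff hΦ (hσ.2 k)).2 (hu_gen k)) ⟨w, hu_conv⟩ hu_bdd hv
      (fun χ g _ hχ => tendsto_left χ g ((sConv_iff hΦ hglue hσ).1 hχ).2) ψ f hf
      ((recoverySeq_iff hΦ hglue hσ).1 hψ)

end Convergence

end MoscoSeq

theorem theorem2p7_general {E : Type*} [MeasurableSpace E]
    (ν : ℕ → Measure E) (carrier : ℕ → Set E)
    (hcarrier_meas : ∀ n, MeasurableSet (carrier n))
    (hcarrier_disj : Pairwise fun m n => Disjoint (carrier m) (carrier n))
    (hcarrier : ∀ n, ν n (carrier n)ᶜ = 0)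
    (α : ℕ → ℝ≥0) (hα_pos : ∀ n, 0 < α n)
    (F : Submodule ℝ (E →ₘ[MoscoSeq.mixture α ν] ℝ))
    (hF_sub : (F : Set (E →ₘ[MoscoSeq.mixture α ν] ℝ)) ⊆ MoscoSeq.classD α ν)
    (hF_dense : Dense (MoscoSeq.trace ν (F : Set (E →ₘ[MoscoSeq.mixture α ν] ℝ)) 0))
    (T : ∀ n, ContractionSemigroup (Lp ℝ 2 (ν n)))
    (hstable : MoscoSeq.ResolventStable F T)
    (hconv : MoscoSeq.FormsConverge F T)
    (β : ℝ) (hβ : 0 < β) :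
    (∀ (fs : ∀ k, Lp ℝ 2 (ν (k + 1))) (f : Lp ℝ 2 (ν 0)),
      MoscoSeq.WConv F (fun k => k + 1) fs f →
      MoscoSeq.WConv F (fun k => k + 1) (fun k => (T (k + 1)).resolvent β (fs k))
          ((T 0).resolvent β f) ∧
        MoscoSeq.WConv F (fun k => k + 1) (fun k => (T (k + 1)).dual.resolvent β (fs k))
          ((T 0).dual.resolvent β f)) ∧
    (∀ (gs : ∀ k, Lp ℝ 2 (ν (k + 1))) (g : Lp ℝ 2 (ν 0)),
      MoscoSeq.SConv F (fun k => k + 1) gs g →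
      MoscoSeq.SConv F (fun k => k + 1) (fun k => (T (k + 1)).resolvent β (gs k))
          ((T 0).resolvent β g) ∧
        MoscoSeq.SConv F (fun k => k + 1) (fun k => (T (k + 1)).dual.resolvent β (gs k))
          ((T 0).dual.resolvent β g)) := by
  have hΦ : VaryingHilbert.ConvergesVia (MoscoSeq.fibreMap hα_pos hF_sub) :=
    MoscoSeq.convergesVia_fibreMap hF_dense
  have hglue := MoscoSeq.exists_forall_ae_eq (ν := ν) hα_pos hcarrier_meas hcarrier_disj hcarrier
  have mosco := hconv.moscoConverge hstable hΦ hglue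
  have hσ := MoscoSeq.isSubseq_succ
  have mem (k : ℕ) {g} := hstable.resolvent_mem_range hΦ hβ (hσ.2 k) (g := g)
  have dual_mem (k : ℕ) {g} := hstable.dual_resolvent_mem_range hΦ hβ (hσ.2 k) (g := g)
  simp only [MoscoSeq.wConv_iff hΦ hglue hσ, MoscoSeq.sConv_iff hΦ hglue hσ]
  constructor
  · rintro fs f ⟨hfs, weak⟩
    exact ⟨⟨fun k => mem k (hfs k), mosco.weakLim_resolvent hβ hσ hfs weak⟩,
      fun k => dual_mem k (hfs k), mosco.weakLim_dual_resolvent hβ hσ weak⟩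
  · rintro gs g ⟨hgs, strong⟩
    exact ⟨⟨fun k => mem k (hgs k), mosco.strongLim_resolvent hβ hσ hgs strong⟩,
      fun k => dual_mem k (hgs k),
      mosco.strongLim_dual_resolvent hβ hσ (fun k => dual_mem k (hgs k)) strong⟩

theorem theorem2p7 {E : Type*} [MeasurableSpace E]
    (ν : ℕ → Measure E) [∀ n, IsProbabilityMeasure (ν n)] (hsep : MeasureTheory.IsSeparable (ν 0))
    (carrier : ℕ → Set E) (hcarrier_meas : ∀ n, MeasurableSet (carrier n))
    (hcarrier_disj : Pairwise fun m n => Disjoint (carrier m) (carrier n))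
    (hcarrier : ∀ n, ν n (carrier n)ᶜ = 0)
    (α : ℕ → ℝ≥0) (hα_pos : ∀ n, 0 < α n) (hα_sum : HasSum α 1)
    (F : Submodule ℝ (E →ₘ[MoscoSeq.mixture α ν] ℝ))
    (hF_sub : (F : Set (E →ₘ[MoscoSeq.mixture α ν] ℝ)) ⊆ MoscoSeq.classD α ν)
    (hF_dense : Dense (MoscoSeq.trace ν (F : Set (E →ₘ[MoscoSeq.mixture α ν] ℝ)) 0))
    (T : ∀ n, ContractionSemigroup (Lp ℝ 2 (ν n)))
    (hstable : MoscoSeq.ResolventStable F T)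
    (hconv : MoscoSeq.FormsConverge F T)
    (β : ℝ) (hβ : 0 < β) :
    (∀ (fs : ∀ k, Lp ℝ 2 (ν (k + 1))) (f : Lp ℝ 2 (ν 0)),
      MoscoSeq.WConv F (fun k => k + 1) fs f →
      MoscoSeq.WConv F (fun k => k + 1) (fun k => (T (k + 1)).resolvent β (fs k))
          ((T 0).resolvent β f) ∧
        MoscoSeq.WConv F (fun k => k + 1) (fun k => (T (k + 1)).dual.resolvent β (fs k))
          ((T 0).dual.resolvent β f)) ∧
    (∀ (gs : ∀ k, Lp ℝ 2 (ν (k + 1))) (g : Lp ℝ 2 (ν 0)),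
      MoscoSeq.SConv F (fun k => k + 1) gs g →
      MoscoSeq.SConv F (fun k => k + 1) (fun k => (T (k + 1)).resolvent β (gs k))
          ((T 0).resolvent β g) ∧
        MoscoSeq.SConv F (fun k => k + 1) (fun k => (T (k + 1)).dual.resolvent β (gs k))
          ((T 0).dual.resolvent β g)) :=
  theorem2p7_general ν carrier hcarrier_meas hcarrier_disj hcarrier α hα_pos F hF_sub hF_dense T
    hstable hconv β hβ
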